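/- Let $(\mathscr{C},\mathbb{E},\mathfrak{s})$ be an extriangulated category (in the sense of Nakaoka–Palu) and, for $n\ge 1$, let $\mathbb{E}^n$ be its higher positive extensions, $\mathbb{E}^1=\mathbb{E}$ and $\mathbb{E}^{n+1}(Z,A)=\int^{X}\mathbb{E}^n(X,A)\otimes_{\mathbb{Z}}\mathbb{E}(Z,X)$. Subcategories are full and closed under isomorphisms. Fix an integer $d\ge 1$ and let $\mathcal{M}$ be a $d$-rigid subcategory, i.e. an additive subcategory with $\mathbb{E}^i(\mathcal{M},\mathcal{M})=0$ for $1\le i\le d$; it is $\infty$-rigid if $\mathbb{E}^i(\mathcal{M},\mathcal{M})=0$ for all $i\ge 1$. An $\mathbb{E}$-triangle sequence $X\to X_1\to\cdots\to X_n\to Z$ is one obtained by splicing $\mathbb{E}$-triangles $X\to X_1\to K_1\dashrightarrow$, $K_1\to X_2\to K_2\dashrightarrow$, …, $K_{n-1}\to X_n\to Z\dashrightarrow$. For $t\ge 0$, $\mathcal{M}^t$ consists of the objects $X$ that have an $\mathcal{M}^L$-filtration of length $t$, i.e. an $\mathbb{E}$-triangle sequence $X\to X_0\to\cdots\to X_t\to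 0$ with all $X_i\in\mathcal{M}$; dually, $\mathcal{M}_t$ consists of the $X$ that have an $\mathcal{M}^R$-filtration $0\to Y_t\to\cdots\to Y_0\to X$ of length $t$ with all $Y_i\in\mathcal{M}$. Put $\mathcal{M}^L=\bigcup_{t\ge 1}\mathcal{M}^t$ and $\mathcal{M}^R=\bigcup_{t\ge 1}\mathcal{M}_t$. For a subcategory $\mathcal{T}$, $K_0^{\rm sp}(\mathcal{T})$ is the free abelian group on the isomorphism classes of objects of $\mathcal{T}$ modulo the relations $[A\oplus B]=[A]+[B]$ (for $A,B,A\oplus B\in\mathcal{T}$), and $K_0(\mathcal{T})$ is its quotient by the relations $[A]-[B]+[Z]=0$ for all $\mathbb{E}$-triangles $A\to B\to Z\dashrightarrow$ with terms in $\mathcal{T}$. The left index ${\rm ind}^L_{\mathcal M}(X)=\sum_{i=0}^{t}(-1)^i[X_i]\in K_0^{\rm sp}(\mathcal{M})$ and the right index ${\rm ind}^R_{\mathcal M}(X)=\sum_{i=0}^{t}(-1)^i[Y_i]\in K_0^{\rm sp}(\mathcal{M})$ are computed from filtrations as above of length $t\le d$ (of any length, if $\mathcal{M}$ is $\infty$-rigid).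 Let ${\rm im}\,\Psi\subseteq K_0^{\rm sp}(\mathcal{M})$ be the subgroup generated by all ${\rm ind}^L_{\mathcal M}(X)-{\rm ind}^R_{\mathcal M}(X)$ with $X\in\mathcal{M}^d\cap\mathcal{M}_1$, let ${\rm im}\,\Phi$ be the subgroup generated by all ${\rm ind}^R_{\mathcal M}(X)-{\rm ind}^L_{\mathcal M}(X)$ with $X\in\mathcal{M}_d\cap\mathcal{M}^1$, and let $K_0^{\rm in}(\mathcal{M})=K_0^{\rm sp}(\mathcal{M})/{\rm im}\,\Psi$. Then: 1. If $1\le t<d$, the assignments $[X]\mapsto{\rm ind}^L_{\mathcal M}(X)$ and $[X]\mapsto{\rm ind}^R_{\mathcal M}(X)$ are well defined (independent of the chosen filtrations) and give group isomorphisms $$K_0(\mathcal{M}^t)\xrightarrow{\ {\rm ind}^L_{\mathcal M},\ \cong\ }K_0^{\rm sp}(\mathcal{M})\xleftarrow{\ {\rm ind}^R_{\mathcal M},\ \cong\ }K_0(\mathcal{M}_t).$$ 2. One has ${\rm im}\,\Phi={\rm im}\,\Psi$, and the left and right indices give well-defined group isomorphisms $$K_0(\mathcal{M}^d)\xrightarrow{\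 {\rm ind}^L_{\mathcal M},\ \cong\ }K_0^{\rm in}(\mathcal{M})\xleftarrow{\ {\rm ind}^R_{\mathcal M},\ \cong\ }K_0(\mathcal{M}_d).$$ 3. If $\mathcal{M}$ is $\infty$-rigid, the left and right indices are well defined and give group isomorphisms $$K_0(\mathcal{M}^L)\xrightarrow{\ {\rm ind}^L_{\mathcal M},\ \cong\ }K_0^{\rm sp}(\mathcal{M})\xleftarrow{\ {\rm ind}^R_{\mathcal M},\ \cong\ }K_0(\mathcal{M}^R).$$ -/

import Mathlib

open CategoryTheory CategoryTheory.Limits Opposite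

universe w v u

namespace Extri

noncomputable section

/-! ### Extriangulated categories -/

section Bifunctor

variable {C : Type u} [Category.{v} C]

/-- The group of extensions `E(Z, A)` of a bifunctor `E : Cᵒᵖ × C → Ab`. -/
abbrev ExtGroup (E : Cᵒᵖ ⥤ C ⥤ AddCommGrpCat.{w}) (Z A : C) : Type w :=
  (E.obj (op Z)).obj A

variable (E : Cᵒᵖ ⥤ C ⥤ AddCommGrpCat.{w})

/-- The covariant action `δ ↦ a_* δ`. -/
def push {A A' : C} (Z : C) (a : A ⟶ A') : ExtGroup E Z A →+ ExtGroup E Z A' :=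
  ((E.obj (op Z)).map a).hom

/-- The contravariant action `δ ↦ c^* δ`. -/
def pull {Z Z' : C} (c : Z' ⟶ Z) (A : C) : ExtGroup E Z A →+ ExtGroup E Z' A :=
  ((E.map c.op).app A).hom

/-- The direct sum `δ ⊕ δ' ∈ E(Z ⊕ Z', A ⊕ A')`, with components `δ, 0, 0, δ'`. -/
def extSum [Preadditive C] [HasBinaryBiproducts C] {Z Z' A A' : C}
    (δ : ExtGroup E Z A) (δ' : ExtGroup E Z' A') : ExtGroup E (Z ⊞ Z') (A ⊞ A') :=
  pull E biprod.fst _ (push E _ biprod.inl δ) + pull E biprod.snd _ (push E _ biprod.inr δ')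

/-- A sequence `A ⟶ B ⟶ Z` with fixed ends. -/
structure Seq (A Z : C) where
  mid : C
  inj : A ⟶ mid
  proj : mid ⟶ Z

/-- Two sequences `A ⟶ B ⟶ Z` and `A ⟶ B' ⟶ Z` are equivalent if some isomorphism `B ≅ B'`
is compatible with the identities of `A` and `Z`. -/
instance seqSetoid (A Z : C) : Setoid (Seq A Z) where
  r S T := ∃ b : S.mid ≅ T.mid, S.inj ≫ b.hom = T.inj ∧ b.hom ≫ T.proj = S.proj
  iseqv :=
    { refl := fun _ => ⟨Iso.refl _, by simp, by simp⟩
      symm := by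
        rintro S T ⟨b, h₁, h₂⟩
        exact ⟨b.symm, by simp [← h₁], by simp [← h₂]⟩
      trans := by
        rintro S T U ⟨b, h₁, h₂⟩ ⟨c, h₃, h₄⟩
        exact ⟨b ≪≫ c, by simp [← h₃, ← h₁], by simp [h₄, h₂]⟩ }

variable {E}

/-- `s(δ) = [A ⟶ B ⟶ Z]`. -/
def Realizes (s : ∀ {Z A : C}, ExtGroup E Z A → Quotient (seqSetoid A Z))
    {A B Z : C} (δ : ExtGroup E Z A) (x : A ⟶ B) (y : B ⟶ Z) : Prop :=
  s δ = Quotient.mk (seqSetoid A Z) ⟨B, x, y⟩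

end Bifunctor

/-- The structure `(E, s)` of an extriangulated category (in the sense of Nakaoka and Palu) on an
additive category `C`. -/
structure Extriangulation (C : Type u) [Category.{v} C] [Preadditive C] [HasZeroObject C]
    [HasBinaryBiproducts C] where
  /-- (ET1) `E` is a biadditive functor. -/
  E : Cᵒᵖ ⥤ C ⥤ AddCommGrpCat.{w}
  additive_left : E.Additive
  additive_right : ∀ Z : Cᵒᵖ, (E.obj Z).Additive
  /-- (ET2) `s` is an additive realization of `E`. -/
  s : ∀ {Z A : C}, ExtGroup E Z A → Quotient (seqSetoid A Z)
  realization : ∀ {A B Z A' B' Z' : C} {δ : ExtGroup E Z A} {δ' : ExtGroup E Z' A'}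
    {x : A ⟶ B} {y : B ⟶ Z} {x' : A' ⟶ B'} {y' : B' ⟶ Z'}, Realizes s δ x y →
    Realizes s δ' x' y' → ∀ (a : A ⟶ A') (c : Z ⟶ Z'), push E Z a δ = pull E c A' δ' →
    ∃ b : B ⟶ B', x ≫ b = a ≫ x' ∧ y ≫ c = b ≫ y'
  realizes_zero : ∀ A Z : C,
    Realizes s (0 : ExtGroup E Z A) (biprod.inl : A ⟶ A ⊞ Z) (biprod.snd : A ⊞ Z ⟶ Z)
  realizes_sum : ∀ {A B Z A' B' Z' : C} {δ : ExtGroup E Z A} {δ' : ExtGroup E Z' A'}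
    {x : A ⟶ B} {y : B ⟶ Z} {x' : A' ⟶ B'} {y' : B' ⟶ Z'}, Realizes s δ x y →
    Realizes s δ' x' y' → Realizes s (extSum E δ δ') (biprod.map x x') (biprod.map y y')
  /-- (ET3) -/
  et3 : ∀ {A B Z A' B' Z' : C} {δ : ExtGroup E Z A} {δ' : ExtGroup E Z' A'}
    {x : A ⟶ B} {y : B ⟶ Z} {x' : A' ⟶ B'} {y' : B' ⟶ Z'}, Realizes s δ x y →
    Realizes s δ' x' y' → ∀ (a : A ⟶ A') (b : B ⟶ B'), x ≫ b = a ≫ x' →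
    ∃ c : Z ⟶ Z', y ≫ c = b ≫ y' ∧ push E Z a δ = pull E c A' δ'
  /-- (ET3)ᵒᵖ -/
  et3_op : ∀ {A B Z A' B' Z' : C} {δ : ExtGroup E Z A} {δ' : ExtGroup E Z' A'}
    {x : A ⟶ B} {y : B ⟶ Z} {x' : A' ⟶ B'} {y' : B' ⟶ Z'}, Realizes s δ x y →
    Realizes s δ' x' y' → ∀ (b : B ⟶ B') (c : Z ⟶ Z'), y ≫ c = b ≫ y' →
    ∃ a : A ⟶ A', x ≫ b = a ≫ x' ∧ push E Z a δ = pull E c A' δ'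
  /-- (ET4) -/
  et4 : ∀ {A B D X F : C} {f : A ⟶ B} {f' : B ⟶ D} {g : B ⟶ X} {g' : X ⟶ F}
    {δ : ExtGroup E D A} {δ' : ExtGroup E F B}, Realizes s δ f f' → Realizes s δ' g g' →
    ∃ (G : C) (h' : X ⟶ G) (d : D ⟶ G) (e : G ⟶ F) (δ'' : ExtGroup E G A),
      Realizes s δ'' (f ≫ g) h' ∧ f' ≫ d = g ≫ h' ∧ h' ≫ e = g' ∧
      Realizes s (push E F f' δ') d e ∧ pull E d A δ'' = δ ∧ push E G f δ'' = pull E e B δ'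
  /-- (ET4)ᵒᵖ -/
  et4_op : ∀ {A B D X F : C} {f' : D ⟶ A} {f : A ⟶ B} {g' : F ⟶ B} {g : B ⟶ X}
    {δ : ExtGroup E B D} {δ' : ExtGroup E X F}, Realizes s δ f' f → Realizes s δ' g' g →
    ∃ (G : C) (h' : G ⟶ A) (d : D ⟶ G) (e : G ⟶ F) (δ'' : ExtGroup E X G),
      Realizes s δ'' h' (f ≫ g) ∧ d ≫ h' = f' ∧ h' ≫ f = e ≫ g' ∧
      Realizes s (pull E g' D δ) d e ∧ push E X e δ'' = δ' ∧ push E B d δ = pull E g G δ''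

/-! ### Higher positive extensions -/

section HigherExt

variable {C : Type u} [Category.{v} C]

/-- Generators `α ⊗ β`, with `α ∈ F(X)` and `β ∈ E(Z, X)`, of the coend `∫^X F(X) ⊗ E(Z, X)`. -/
abbrev TensorGen (E : Cᵒᵖ ⥤ C ⥤ AddCommGrpCat.{w}) (F : Cᵒᵖ ⥤ AddCommGrpCat.{max u w})
    (Z : C) : Type (max u w) :=
  Σ X : C, F.obj (op X) × ExtGroup E Z X

/-- The defining relations of the coend `∫^X F(X) ⊗ E(Z, X)`: biadditivity of `⊗` and
`f^* α ⊗ β = α ⊗ f_* β`. -/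
inductive TensorRel (E : Cᵒᵖ ⥤ C ⥤ AddCommGrpCat.{w}) (F : Cᵒᵖ ⥤ AddCommGrpCat.{max u w})
    (Z : C) : FreeAbelianGroup (TensorGen E F Z) → Prop
  | add_left {X : C} (α α' : F.obj (op X)) (β : ExtGroup E Z X) :
      TensorRel E F Z (FreeAbelianGroup.of ⟨X, α + α', β⟩ -
        FreeAbelianGroup.of ⟨X, α, β⟩ - FreeAbelianGroup.of ⟨X, α', β⟩)
  | add_right {X : C} (α : F.obj (op X)) (β β' : ExtGroup E Z X) :
      TensorRel E F Z (FreeAbelianGroup.of ⟨X, α, β + β'⟩ -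
        FreeAbelianGroup.of ⟨X, α, β⟩ - FreeAbelianGroup.of ⟨X, α, β'⟩)
  | balanced {X X' : C} (f : X ⟶ X') (α : F.obj (op X')) (β : ExtGroup E Z X) :
      TensorRel E F Z (FreeAbelianGroup.of ⟨X, (F.map f.op).hom α, β⟩ -
        FreeAbelianGroup.of ⟨X', α, push E Z f β⟩)

/-- The subgroup generated by the relations of the coend. -/
def tensorRel (E : Cᵒᵖ ⥤ C ⥤ AddCommGrpCat.{w}) (F : Cᵒᵖ ⥤ AddCommGrpCat.{max u w})
    (Z : C) : AddSubgroup (FreeAbelianGroup (TensorGen E F Z)) :=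
  AddSubgroup.closure {r | TensorRel E F Z r}

/-- The action of `c : Z' ⟶ Z` on generators, `α ⊗ β ↦ α ⊗ c^* β`. -/
def tensorGenMap (E : Cᵒᵖ ⥤ C ⥤ AddCommGrpCat.{w}) (F : Cᵒᵖ ⥤ AddCommGrpCat.{max u w})
    {Z Z' : C} (c : Z' ⟶ Z) : TensorGen E F Z → TensorGen E F Z' :=
  fun t => ⟨t.1, t.2.1, pull E c t.1 t.2.2⟩

theorem pull_push (E : Cᵒᵖ ⥤ C ⥤ AddCommGrpCat.{w}) {Z Z' A A' : C} (c : Z' ⟶ Z)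
    (a : A ⟶ A') (δ : ExtGroup E Z A) :
    pull E c A' (push E Z a δ) = push E Z' a (pull E c A δ) :=
  ConcreteCategory.congr_hom ((E.map c.op).naturality a) δ

theorem tensorRel_le (E : Cᵒᵖ ⥤ C ⥤ AddCommGrpCat.{w}) (F : Cᵒᵖ ⥤ AddCommGrpCat.{max u w})
    {Z Z' : C} (c : Z' ⟶ Z) :
    tensorRel E F Z ≤ (tensorRel E F Z').comap (FreeAbelianGroup.map (tensorGenMap E F c)) := by
  refine (AddSubgroup.closure_le _).2 ?_
  rintro _ (⟨α, α', β⟩ | ⟨α, β, β'⟩ | ⟨f, α, β⟩) <;>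
    refine AddSubgroup.subset_closure ?_ <;>
    simp only [map_sub, FreeAbelianGroup.map_of_apply, tensorGenMap, map_add, Set.mem_ofPred_eq,
      pull_push]
  · exact TensorRel.add_left _ _ _
  · exact TensorRel.add_right _ _ _
  · exact TensorRel.balanced _ _ _

/-- The contravariant functor `Z ↦ ∫^X F(X) ⊗ E(Z, X)`. -/
def tensorExt (E : Cᵒᵖ ⥤ C ⥤ AddCommGrpCat.{w}) (F : Cᵒᵖ ⥤ AddCommGrpCat.{max u w}) :
    Cᵒᵖ ⥤ AddCommGrpCat.{max u w} where
  obj Z := AddCommGrpCat.of (FreeAbelianGroup (TensorGen E F Z.unop) ⧸ tensorRel E F Z.unop)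
  map c := AddCommGrpCat.ofHom (QuotientAddGroup.map _ _
    (FreeAbelianGroup.map (tensorGenMap E F c.unop)) (tensorRel_le E F c.unop))
  map_id Z := by
    ext : 1
    refine QuotientAddGroup.addMonoidHom_ext _ (FreeAbelianGroup.lift_ext _ _ ?_)
    rintro ⟨X, α, β⟩
    simp [tensorGenMap, pull]
  map_comp c c' := by
    ext : 1
    refine QuotientAddGroup.addMonoidHom_ext _ (FreeAbelianGroup.lift_ext _ _ ?_)
    rintro ⟨X, α, β⟩
    simp [tensorGenMap, pull]

/-- `posExt E A n` is the functor `E^{n+1}(-, A)`, where `E^1 = E` and `E^{n+1} = E^n ◇ E`, that is,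
`E^{n+1}(Z, A) = ∫^X E^n(X, A) ⊗ E(Z, X)`. -/
def posExt (E : Cᵒᵖ ⥤ C ⥤ AddCommGrpCat.{w}) (A : C) : ℕ → (Cᵒᵖ ⥤ AddCommGrpCat.{max u w})
  | 0 => E.flip.obj A ⋙ AddCommGrpCat.uliftFunctor.{u, w}
  | n + 1 => tensorExt E (posExt E A n)

/-- The positive extension group `E^n(Z, A)`, for `n ≥ 1` (the value at `n = 0` is not used). -/
abbrev HigherExt (E : Cᵒᵖ ⥤ C ⥤ AddCommGrpCat.{w}) (n : ℕ) (Z A : C) : Type (max u w) :=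
  (posExt E A (n - 1)).obj (op Z)

end HigherExt

variable {C : Type u} [Category.{v} C] [Preadditive C] [HasZeroObject C] [HasBinaryBiproducts C]

/-! ### Subcategories and filtrations -/

open scoped ZeroObject in
/-- Full additive subcategories (closed under isomorphisms, as are all subcategories here). -/
structure IsAdditiveSubcategory (M : ObjectProperty C) : Prop where
  of_iso : ∀ {X Y : C}, (X ≅ Y) → M X → M Y
  zero : M (0 : C)
  biprod : ∀ {X Y : C}, M X → M Y → M (X ⊞ Y)

/-- `M` is `d`-rigid: an additive full subcategory with `E^i(M, M) = 0` for `1 ≤ i ≤ d`. -/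
structure IsRigid (S : Extriangulation.{w} C) (M : ObjectProperty C) (d : ℕ) : Prop where
  additive : IsAdditiveSubcategory M
  ext_eq_zero : ∀ i : ℕ, 1 ≤ i → i ≤ d → ∀ {X Y : C}, M X → M Y →
    Subsingleton (HigherExt S.E i X Y)

/-- `M` is `∞`-rigid: an additive full subcategory with `E^i(M, M) = 0` for all `i ≥ 1`. -/
structure IsInftyRigid (S : Extriangulation.{w} C) (M : ObjectProperty C) : Prop where
  additive : IsAdditiveSubcategory M
  ext_eq_zero : ∀ i : ℕ, 1 ≤ i → ∀ {X Y : C}, M X → M Y → Subsingleton (HigherExt S.E i X Y)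

/-- There is an `E`-triangle `A ⟶ B ⟶ Z ⇢`. -/
def HasTriangle (S : Extriangulation.{w} C) (A B Z : C) : Prop :=
  ∃ (x : A ⟶ B) (y : B ⟶ Z) (δ : ExtGroup S.E Z A), Realizes S.s δ x y

/-- `HasTriangleSeq S X [X₁, …, Xₙ] Z` says that there is an `E`-triangle sequence
`X ⟶ X₁ ⟶ ⋯ ⟶ Xₙ ⟶ Z`, i.e. that there are objects `K₁, …, Kₙ₋₁` and `E`-triangles
`X ⟶ X₁ ⟶ K₁ ⇢`, `K₁ ⟶ X₂ ⟶ K₂ ⇢`, …, `Kₙ₋₁ ⟶ Xₙ ⟶ Z ⇢`; the morphism `Xᵢ ⟶ Xᵢ₊₁` of the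
sequence is the composite `Xᵢ ⟶ Kᵢ ⟶ Xᵢ₊₁`. -/
inductive HasTriangleSeq (S : Extriangulation.{w} C) : C → List C → C → Prop
  | single {X X₁ Z : C} (h : HasTriangle S X X₁ Z) : HasTriangleSeq S X [X₁] Z
  | cons {X X₁ K Z : C} {L : List C} (h : HasTriangle S X X₁ K) (hL : HasTriangleSeq S K L Z) :
      HasTriangleSeq S X (X₁ :: L) Z

/-- The objects of a full subcategory, given by a property of objects. -/
abbrev Obj (T : ObjectProperty C) : Type u := {X : C // T X}

open scoped ZeroObject in
/-- `L = [X₀, …, X_t]` are the terms, all in `M`, of an `M^L`-filtration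
`X ⟶ X₀ ⟶ ⋯ ⟶ X_t ⟶ 0` of length `t` of `X`. -/
structure IsLeftFiltration (S : Extriangulation.{w} C) (M : ObjectProperty C) (t : ℕ) (X : C)
    (L : List (Obj M)) : Prop where
  length_eq : L.length = t + 1
  seq : HasTriangleSeq S X (L.map Subtype.val) 0

open scoped ZeroObject in
/-- `L = [Y₀, …, Y_t]` are the terms, all in `M`, of an `M^R`-filtration
`0 ⟶ Y_t ⟶ ⋯ ⟶ Y₀ ⟶ X` of length `t` of `X`. -/
structure IsRightFiltration (S : Extriangulation.{w} C) (M : ObjectProperty C) (t : ℕ) (X : C)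
    (L : List (Obj M)) : Prop where
  length_eq : L.length = t + 1
  seq : HasTriangleSeq S 0 (L.reverse.map Subtype.val) X

/-- `M^t`: the objects with an `M^L`-filtration of length `t`. -/
def leftPart (S : Extriangulation.{w} C) (M : ObjectProperty C) (t : ℕ) : ObjectProperty C :=
  fun X => ∃ L, IsLeftFiltration S M t X L

/-- `M_t`: the objects with an `M^R`-filtration of length `t`. -/
def rightPart (S : Extriangulation.{w} C) (M : ObjectProperty C) (t : ℕ) : ObjectProperty C :=
  fun X => ∃ L, IsRightFiltration S M t X L

/-- `M^L`, the union of all `M^t`, `t ≥ 1`. -/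
def leftUnion (S : Extriangulation.{w} C) (M : ObjectProperty C) : ObjectProperty C :=
  fun X => ∃ t : ℕ, 1 ≤ t ∧ leftPart S M t X

/-- `M^R`, the union of all `M_t`, `t ≥ 1`. -/
def rightUnion (S : Extriangulation.{w} C) (M : ObjectProperty C) : ObjectProperty C :=
  fun X => ∃ t : ℕ, 1 ≤ t ∧ rightPart S M t X

/-! ### Grothendieck groups -/

/-- Isomorphism of objects of a full subcategory. -/
instance objSetoid (T : ObjectProperty C) : Setoid (Obj T) where
  r X Y := Nonempty (X.1 ≅ Y.1)
  iseqv := ⟨fun _ => ⟨Iso.refl _⟩, fun ⟨e⟩ => ⟨e.symm⟩, fun ⟨e⟩ ⟨f⟩ => ⟨e ≪≫ f⟩⟩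

/-- The free abelian group on the isomorphism classes of objects of `T`. -/
abbrev FreeIso (T : ObjectProperty C) : Type u := FreeAbelianGroup (Quotient (objSetoid T))

/-- The generator of the free abelian group given by an object of `T`. -/
def freeClass {T : ObjectProperty C} (X : Obj T) : FreeIso T :=
  FreeAbelianGroup.of (Quotient.mk (objSetoid T) X)

/-- The subgroup generated by the `[A ⊕ B] - [A] - [B]` with `A`, `B` (and `A ⊕ B`) in `T`. -/
def splitRel (T : ObjectProperty C) : AddSubgroup (FreeIso T) :=
  AddSubgroup.closure {r | ∃ (A B : C) (hA : T A) (hB : T B) (hAB : T (A ⊞ B)),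
    r = freeClass ⟨A ⊞ B, hAB⟩ - freeClass ⟨A, hA⟩ - freeClass ⟨B, hB⟩}

/-- The split Grothendieck group `K₀^sp(T)`. -/
abbrev K0sp (T : ObjectProperty C) : Type u := FreeIso T ⧸ splitRel T

/-- The class `[X]` in `K₀^sp(T)`. -/
def spClass {T : ObjectProperty C} (X : Obj T) : K0sp T := QuotientAddGroup.mk (freeClass X)

/-- The subgroup of `K₀^sp(T)` generated by the `[A] - [B] + [Z]` for the `E`-triangles
`A ⟶ B ⟶ Z ⇢` with terms in `T`. -/
def triangleRel (S : Extriangulation.{w} C) (T : ObjectProperty C) : AddSubgroup (K0sp T) :=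
  AddSubgroup.closure {r | ∃ A B Z : Obj T, HasTriangle S A.1 B.1 Z.1 ∧
    r = spClass A - spClass B + spClass Z}

/-- The Grothendieck group `K₀(T)`. -/
abbrev K0 (S : Extriangulation.{w} C) (T : ObjectProperty C) : Type u :=
  K0sp T ⧸ triangleRel S T

/-- The class `[X]` in `K₀(T)`. -/
def k0Class (S : Extriangulation.{w} C) {T : ObjectProperty C} (X : Obj T) : K0 S T :=
  QuotientAddGroup.mk (spClass X)

/-- The alternating sum `[X₀] - [X₁] + [X₂] - ⋯` in `K₀^sp(M)`. -/
def altSum {M : ObjectProperty C} (L : List (Obj M)) : K0sp M := (L.map spClass).alternatingSum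

/-- `g` is a left index of `X`, computed from an `M^L`-filtration of length at most `d`. -/
def IsLeftIndex (S : Extriangulation.{w} C) (M : ObjectProperty C) (d : ℕ) (X : C)
    (g : K0sp M) : Prop :=
  ∃ (t : ℕ) (L : List (Obj M)), t ≤ d ∧ IsLeftFiltration S M t X L ∧ g = altSum L

/-- `g` is a right index of `X`, computed from an `M^R`-filtration of length at most `d`. -/
def IsRightIndex (S : Extriangulation.{w} C) (M : ObjectProperty C) (d : ℕ) (X : C)
    (g : K0sp M) : Prop :=
  ∃ (t : ℕ) (L : List (Obj M)), t ≤ d ∧ IsRightFiltration S M t X L ∧ g = altSum L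

/-- The subgroup generated by the image of `Ψ`, that is, by the values
`Ψ(E(X, -)|_M) = ind^L(X) - ind^R(X)` for `X` in `M^d ∩ M_1`. -/
def imPsi (S : Extriangulation.{w} C) (M : ObjectProperty C) (d : ℕ) : AddSubgroup (K0sp M) :=
  AddSubgroup.closure {r | ∃ (X : C) (g h : K0sp M), leftPart S M d X ∧ rightPart S M 1 X ∧
    IsLeftIndex S M d X g ∧ IsRightIndex S M d X h ∧ r = g - h}

/-- The subgroup generated by the image of `Φ`, that is, by the values
`Φ(E(-, X)|_M) = ind^R(X) - ind^L(X)` for `X` in `M_d ∩ M^1`. -/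
def imPhi (S : Extriangulation.{w} C) (M : ObjectProperty C) (d : ℕ) : AddSubgroup (K0sp M) :=
  AddSubgroup.closure {r | ∃ (X : C) (g h : K0sp M), rightPart S M d X ∧ leftPart S M 1 X ∧
    IsRightIndex S M d X g ∧ IsLeftIndex S M d X h ∧ r = g - h}

/-- The index Grothendieck group `K₀^in(M) = K₀^sp(M) / im Ψ`. -/
abbrev K0in (S : Extriangulation.{w} C) (M : ObjectProperty C) (d : ℕ) : Type u :=
  K0sp M ⧸ imPsi S M d

end

end Extri

/-!
# Grothendieck groups of the left and right parts of a rigid subcategory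

An object of `M^t` has a coresolution of length `t` by objects of `M`, and its left index is the
alternating sum of the terms. Rigidity of `M` shifts along the triangles of the coresolution: if `X`
has a coresolution of length `j`, then `E^i(X, M) = 0` for `1 ≤ i ≤ d - j`. So triangles
`N ⟶ B ⟶ X` with `N` in `M` and `j < d` split (`SplitsBelow`), and this is all that is used of
rigidity from there on.

* Schanuel's lemma (`IsResolved.unique`): comparing two coresolutions through the pushout of their
  first steps, the index is well defined for lengths up to `d`.
* The horseshoe lemma (`IsResolved.extension`): the index is additive on triangles whose third term
  has length less than `d`.

For `t < d` the index is therefore a homomorphism on `K₀(M^t)`, and it is inverse to the map induced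
by `M ⊆ M^t`, because a coresolution expresses the class of an object through classes of objects
of `M`. For `t = d` additivity may fail, but the defect of any triangle is that of a triangle
`A ⟶ B ⟶ X` with `A` and `B` in `M`, obtained by replacing first the first and then the middle term
(`IsResolved.exists_reduction`), and the latter is precisely a value of `Ψ`. Moving `X` along its
coresolution turns such a triangle into one `X' ⟶ B' ⟶ A'` for which `X'` has a resolution of length
`d`, with the same defect up to sign (`IsResolved.exists_shift`), whence `im Φ = im Ψ`.

These arguments only see which triples of objects are the terms of a triangle, through properties
that are preserved by reversing all triangles (`IsTriangleRel`). The statements on right indices are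
those on left indices for the reversed relation.

Only the shift of vanishing depends on the higher extensions, and it needs their long exact
sequences in both variables. In the first variable (`HalfExact.exists_of_tmk_eq_zero`), the
vanishing of `α ⊗ δ` in the coend is witnessed by finitely many relations, all of whose extensions
are pushouts of a single one `κ`; for those, `α ⊗ u_* κ ↦ u^* α` is well defined modulo restrictions from the
middle term of `κ`. In the second variable (`exactAt_posExt`), one inducts along `E^{n+1} = E^n ◇ E`
and removes the obstruction by enlarging a deflation, since positive extensions are effaceable.
-/

namespace Extri

/-! ### The actions on extension groups -/

section Actions

variable {C : Type u} [Category.{v} C] (E : Cᵒᵖ ⥤ C ⥤ AddCommGrpCat.{w})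

theorem push_id (Z A : C) (δ : ExtGroup E Z A) : push E Z (𝟙 A) δ = δ := by simp [push]

theorem push_comp {Z A A' A'' : C} (a : A ⟶ A') (a' : A' ⟶ A'') (δ : ExtGroup E Z A) :
    push E Z (a ≫ a') δ = push E Z a' (push E Z a δ) := by simp [push]

theorem pull_id (Z A : C) (δ : ExtGroup E Z A) : pull E (𝟙 Z) A δ = δ := by simp [pull]

theorem pull_comp {Z Z' Z'' A : C} (c' : Z'' ⟶ Z') (c : Z' ⟶ Z) (δ : ExtGroup E Z A) :
    pull E (c' ≫ c) A δ = pull E c' A (pull E c A δ) := by simp [pull]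

end Actions

theorem isIso_of_isIso_comp {C : Type u} [Category.{v} C] {X Y : C} (f : X ⟶ Y) (g : Y ⟶ X)
    (h₁ : IsIso (f ≫ g)) (h₂ : IsIso (g ≫ f)) : IsIso f := by
  have : IsSplitMono f := IsSplitMono.mk' ⟨g ≫ inv (f ≫ g), by
    rw [← Category.assoc, IsIso.hom_inv_id]⟩
  have : IsSplitEpi f := IsSplitEpi.mk' ⟨inv (g ≫ f) ≫ g, by simp⟩
  exact isIso_of_mono_of_isSplitEpi f

variable {C : Type u} [Category.{v} C] [Preadditive C] [HasZeroObject C] [HasBinaryBiproducts C]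
  (S : Extriangulation.{w} C)

theorem push_add {Z A A' : C} (a a' : A ⟶ A') (δ : ExtGroup S.E Z A) :
    push S.E Z (a + a') δ = push S.E Z a δ + push S.E Z a' δ := by
  have := S.additive_right (op Z)
  simp [push, Functor.map_add]

theorem pull_add {Z Z' A : C} (c c' : Z' ⟶ Z) (δ : ExtGroup S.E Z A) :
    pull S.E (c + c') A δ = pull S.E c A δ + pull S.E c' A δ := by
  have := S.additive_left
  simp [pull, Functor.map_add]

theorem push_zero {Z A A' : C} (δ : ExtGroup S.E Z A) :
    push S.E Z (0 : A ⟶ A') δ = 0 := by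
  have := push_add S (0 : A ⟶ A') 0 δ
  simpa using this

theorem pull_zero {Z Z' A : C} (δ : ExtGroup S.E Z A) :
    pull S.E (0 : Z' ⟶ Z) A δ = 0 := by
  have := pull_add S (0 : Z' ⟶ Z) 0 δ
  simpa using this

theorem ext_eq_zero_of_isZero_left {Z A : C} (hZ : IsZero Z) (δ : ExtGroup S.E Z A) : δ = 0 := by
  rw [← pull_id S.E Z A δ, hZ.eq_of_src (𝟙 Z) 0, pull_zero]

theorem ext_eq_zero_of_isZero_right {Z A : C} (hA : IsZero A) (δ : ExtGroup S.E Z A) :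
    δ = 0 := by
  rw [← push_id S.E Z A δ, hA.eq_of_src (𝟙 A) 0, push_zero]

/-! ### Realizations of extensions -/

theorem exists_realizes {Z A : C} (δ : ExtGroup S.E Z A) :
    ∃ (B : C) (x : A ⟶ B) (y : B ⟶ Z), Realizes S.s δ x y := by
  obtain ⟨⟨B, x, y⟩, h⟩ := Quotient.exists_rep (S.s δ)
  exact ⟨B, x, y, h.symm⟩

variable {S}

namespace Realizes

theorem exists_iso {A B B' Z : C} {δ : ExtGroup S.E Z A} {x : A ⟶ B} {y : B ⟶ Z} {x' : A ⟶ B'}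
    {y' : B' ⟶ Z} (h : Realizes S.s δ x y) (h' : Realizes S.s δ x' y') :
    ∃ b : B ≅ B', x ≫ b.hom = x' ∧ b.hom ≫ y' = y :=
  Quotient.exact (h.symm.trans h')

theorem of_iso {A B B' Z : C} {δ : ExtGroup S.E Z A} {x : A ⟶ B} {y : B ⟶ Z} {x' : A ⟶ B'}
    {y' : B' ⟶ Z} (h : Realizes S.s δ x y) (b : B ≅ B') (hx : x ≫ b.hom = x')
    (hy : b.hom ≫ y' = y) : Realizes S.s δ x' y' :=
  Eq.trans h (Quotient.sound ⟨b, hx, hy⟩)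

end Realizes

/-- The split triangle `A ⟶ B ⟶ 0` given by an isomorphism. -/
theorem realizes_iso_zero {A B Z : C} (a : A ≅ B) (hZ : IsZero Z) :
    Realizes S.s (0 : ExtGroup S.E Z A) a.hom (0 : B ⟶ Z) := by
  refine (S.realizes_zero A Z).of_iso
    ⟨biprod.fst ≫ a.hom, a.inv ≫ biprod.inl, ?_, by simp⟩ (by simp) (hZ.eq_of_tgt _ _)
  ext <;> simp
  exact hZ.eq_of_src _ _

/-- The split triangle `0 ⟶ B ⟶ Z` given by an isomorphism. -/
theorem realizes_zero_iso {A B Z : C} (c : B ≅ Z) (hA : IsZero A) :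
    Realizes S.s (0 : ExtGroup S.E Z A) (0 : A ⟶ B) c.hom := by
  refine (S.realizes_zero A Z).of_iso
    ⟨biprod.snd ≫ c.inv, c.hom ≫ biprod.inr, ?_, by simp⟩ (hA.eq_of_src _ _) (by simp)
  ext <;> simp
  exact hA.eq_of_src _ _

/-- The split triangle with the summands of the middle term interchanged. -/
theorem realizes_inr_fst (A Z : C) :
    Realizes S.s (0 : ExtGroup S.E Z A) (biprod.inr : A ⟶ Z ⊞ A) (biprod.fst : Z ⊞ A ⟶ Z) :=
  (S.realizes_zero A Z).of_iso (biprod.braiding A Z) (by ext <;> simp) (by simp)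

open scoped ZeroObject

namespace Realizes

variable {A B Z : C} {δ : ExtGroup S.E Z A} {x : A ⟶ B} {y : B ⟶ Z}

theorem pull_eq_zero (h : Realizes S.s δ x y) : pull S.E y A δ = 0 := by
  obtain ⟨a, -, ha⟩ := S.et3_op (realizes_zero_iso (Iso.refl B) (isZero_zero C)) h (𝟙 B) y
    (by simp)
  simpa using ha.symm

/-- A morphism out of the middle term that vanishes on `A` factors through `y`. -/
theorem exists_desc (h : Realizes S.s δ x y) {W : C} (f : B ⟶ W) (hf : x ≫ f = 0) :
    ∃ g : Z ⟶ W, y ≫ g = f := by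
  obtain ⟨c, hc, -⟩ := S.et3 h (realizes_zero_iso (Iso.refl W) (isZero_zero C)) 0 f (by simp [hf])
  exact ⟨c, by simpa using hc⟩

/-- A morphism `u` out of the first term with `u_* δ = 0` extends along `x`. -/
theorem exists_extension (h : Realizes S.s δ x y) {X : C} (u : A ⟶ X)
    (hu : push S.E Z u δ = 0) : ∃ v : B ⟶ X, x ≫ v = u := by
  obtain ⟨b, hb, -⟩ := S.realization h (S.realizes_zero X Z) u (𝟙 Z) (by simp [hu])
  exact ⟨b ≫ biprod.fst, by rw [reassoc_of% hb]; simp⟩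

/-- An endomorphism of the middle term that induces the identity on both ends is invertible:
it differs from the identity by a morphism of square zero. -/
theorem isIso_of_endo (h : Realizes S.s δ x y) (f : B ⟶ B) (hx : x ≫ f = x) (hy : f ≫ y = y) :
    IsIso f := by
  obtain ⟨g, hg⟩ := h.exists_desc (f - 𝟙 B) (by simp [hx])
  have hsq : (f - 𝟙 B) ≫ (f - 𝟙 B) = 0 := by
    conv_lhs => rw [← hg]
    rw [← Category.assoc, hg, Preadditive.sub_comp, hy]
    simp
  simp only [Preadditive.sub_comp, Preadditive.comp_sub, Category.comp_id, Category.id_comp]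
    at hsq
  refine ⟨𝟙 B + 𝟙 B - f, ?_, ?_⟩ <;>
    simp only [Preadditive.sub_comp, Preadditive.comp_sub, Category.comp_id, Category.id_comp,
      Preadditive.add_comp, Preadditive.comp_add]
  · rw [← sub_eq_zero, ← neg_eq_zero, ← hsq]; abel
  · rw [← sub_eq_zero, ← neg_eq_zero, ← hsq]; abel

end Realizes

namespace Realizes

variable {A B Z : C} {δ : ExtGroup S.E Z A} {x : A ⟶ B} {y : B ⟶ Z}

theorem isIso_of_inverse_ends {A' B' Z' : C} {δ' : ExtGroup S.E Z' A'} {x' : A' ⟶ B'}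
    {y' : B' ⟶ Z'} (h : Realizes S.s δ x y) (h' : Realizes S.s δ' x' y') (a : A ≅ A')
    (c : Z ≅ Z') (b : B ⟶ B') (b' : B' ⟶ B) (h₁ : x ≫ b = a.hom ≫ x')
    (h₂ : y ≫ c.hom = b ≫ y') (h₃ : x' ≫ b' = a.inv ≫ x) (h₄ : y' ≫ c.inv = b' ≫ y) :
    IsIso b := by
  refine isIso_of_isIso_comp b b' (h.isIso_of_endo _ ?_ ?_) (h'.isIso_of_endo _ ?_ ?_)
  · rw [← Category.assoc, h₁, Category.assoc, h₃, a.hom_inv_id_assoc]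
  · rw [Category.assoc, ← h₄, ← Category.assoc, ← h₂, Category.assoc, c.hom_inv_id,
      Category.comp_id]
  · rw [← Category.assoc, h₃, Category.assoc, h₁, a.inv_hom_id_assoc]
  · rw [Category.assoc, ← h₂, ← Category.assoc, ← h₄, Category.assoc, c.inv_hom_id,
      Category.comp_id]

/-- Realizations can be transported along isomorphisms of the end terms. -/
theorem exists_of_iso_ends (h : Realizes S.s δ x y) {A' Z' : C} (a : A ≅ A') (c : Z ≅ Z') :
    Realizes S.s (push S.E Z' a.hom (pull S.E c.inv A δ)) (a.inv ≫ x) (y ≫ c.hom) := by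
  obtain ⟨B', x', y', h'⟩ := exists_realizes S (push S.E Z' a.hom (pull S.E c.inv A δ))
  obtain ⟨b, h₁, h₂⟩ := S.realization h h' a.hom c.hom (by
    rw [pull_push, ← pull_comp, c.hom_inv_id, pull_id])
  obtain ⟨b', h₃, h₄⟩ := S.realization h' h a.inv c.inv (by
    rw [← push_comp, a.hom_inv_id, push_id])
  have := h.isIso_of_inverse_ends h' a c b b' h₁ h₂ h₃ h₄
  refine h'.of_iso (asIso b).symm ?_ ?_
  · rw [Iso.symm_hom, asIso_inv, IsIso.comp_inv_eq, Category.assoc, h₁, a.inv_hom_id_assoc]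
  · rw [Iso.symm_hom, asIso_inv, IsIso.inv_comp_eq, h₂]

end Realizes

/-! ### Triangles up to isomorphism -/

theorem hasTriangle_of_iso {A B Z A' B' Z' : C} (a : A ≅ A') (b : B ≅ B') (c : Z ≅ Z')
    (h : HasTriangle S A B Z) : HasTriangle S A' B' Z' := by
  obtain ⟨x, y, δ, h⟩ := h
  exact ⟨_, _, _, (h.exists_of_iso_ends a c).of_iso b rfl (b.hom_inv_id_assoc _)⟩

theorem hasTriangle_biprod (A Z : C) : HasTriangle S A (A ⊞ Z) Z :=
  ⟨_, _, _, S.realizes_zero A Z⟩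

theorem hasTriangle_sum {A B Z A' B' Z' : C} (h : HasTriangle S A B Z)
    (h' : HasTriangle S A' B' Z') : HasTriangle S (A ⊞ A') (B ⊞ B') (Z ⊞ Z') := by
  obtain ⟨x, y, δ, h⟩ := h
  obtain ⟨x', y', δ', h'⟩ := h'
  exact ⟨_, _, _, S.realizes_sum h h'⟩

/-- The octahedral axiom (ET4) for the terms of triangles; any two triangles of this shape are
composable. -/
theorem hasTriangle_comp {A B D X F : C} (h : HasTriangle S A B D) (h' : HasTriangle S B X F) :
    ∃ G, HasTriangle S A X G ∧ HasTriangle S D G F := by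
  obtain ⟨x, y, δ, h⟩ := h
  obtain ⟨x', y', δ', h'⟩ := h'
  obtain ⟨G, _, _, _, _, h₁, -, -, h₂, -, -⟩ := S.et4 h h'
  exact ⟨G, ⟨_, _, _, h₁⟩, ⟨_, _, _, h₂⟩⟩

theorem hasTriangle_comp_op {A B D X F : C} (h : HasTriangle S D A B)
    (h' : HasTriangle S F B X) : ∃ G, HasTriangle S G A X ∧ HasTriangle S D G F := by
  obtain ⟨x, y, δ, h⟩ := h
  obtain ⟨x', y', δ', h'⟩ := h'
  obtain ⟨G, _, _, _, _, h₁, -, -, h₂, -, -⟩ := S.et4_op h h'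
  exact ⟨G, ⟨_, _, _, h₁⟩, ⟨_, _, _, h₂⟩⟩

theorem nonempty_iso_biprod_of_subsingleton {A B Z : C} (hE : Subsingleton (ExtGroup S.E Z A))
    (h : HasTriangle S A B Z) : Nonempty (B ≅ A ⊞ Z) := by
  obtain ⟨x, y, δ, h⟩ := h
  rw [hE.elim δ 0] at h
  exact ⟨(h.exists_iso (S.realizes_zero A Z)).choose⟩

theorem Realizes.nonempty_iso {A B B' Z : C} {δ δ' : ExtGroup S.E Z A} {x : A ⟶ B} {y : B ⟶ Z}
    {x' : A ⟶ B'} {y' : B' ⟶ Z} (h : Realizes S.s δ x y) (h' : Realizes S.s δ' x' y')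
    (hδ : δ = δ') : Nonempty (B ≅ B') := by
  subst hδ
  exact ⟨(h.exists_iso h').choose⟩

/-- Two triangles with the same first term have a pushout. -/
theorem hasTriangle_pushout {X Y Z Y' Z' : C} (h : HasTriangle S X Y Z)
    (h' : HasTriangle S X Y' Z') : ∃ P, HasTriangle S Y P Z' ∧ HasTriangle S Y' P Z := by
  obtain ⟨x, y, δ, h⟩ := h
  obtain ⟨x', y', δ', h'⟩ := h'
  -- The pushout is the middle term of the extension of `Z ⊞ Z'` with components `δ` and `δ'`.
  obtain ⟨P, k, p, hP⟩ := exists_realizes S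
    (pull S.E (biprod.fst : Z ⊞ Z' ⟶ Z) X δ + pull S.E (biprod.snd : Z ⊞ Z' ⟶ Z') X δ')
  obtain ⟨G, _, _, _, _, h₁, -, -, h₂, -, -⟩ := S.et4_op hP (S.realizes_zero Z Z')
  obtain ⟨G', _, _, _, _, h₁', -, -, h₂', -, -⟩ := S.et4_op hP (realizes_inr_fst Z' Z)
  obtain ⟨e⟩ := h₂.nonempty_iso h (by
    rw [map_add, ← pull_comp, ← pull_comp, biprod.inl_fst, biprod.inl_snd, pull_id, pull_zero,
      add_zero])
  obtain ⟨e'⟩ := h₂'.nonempty_iso h' (by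
    rw [map_add, ← pull_comp, ← pull_comp, biprod.inr_fst, biprod.inr_snd, pull_id, pull_zero,
      zero_add])
  exact ⟨P, hasTriangle_of_iso e (Iso.refl _) (Iso.refl _) ⟨_, _, _, h₁⟩,
    hasTriangle_of_iso e' (Iso.refl _) (Iso.refl _) ⟨_, _, _, h₁'⟩⟩

/-- Two triangles with the same third term have a pullback. -/
theorem hasTriangle_pullback {A B Z A' B' : C} (h : HasTriangle S A B Z)
    (h' : HasTriangle S A' B' Z) : ∃ P, HasTriangle S A' P B ∧ HasTriangle S A P B' := by
  obtain ⟨x, y, δ, h⟩ := h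
  obtain ⟨x', y', δ', h'⟩ := h'
  obtain ⟨P, k, p, hP⟩ := exists_realizes S
    (push S.E Z (biprod.inl : A ⟶ A ⊞ A') δ + push S.E Z (biprod.inr : A' ⟶ A ⊞ A') δ')
  obtain ⟨G, _, _, _, _, h₁, -, -, h₂, -, -⟩ := S.et4 (S.realizes_zero A A') hP
  obtain ⟨G', _, _, _, _, h₁', -, -, h₂', -, -⟩ := S.et4 (realizes_inr_fst A' A) hP
  obtain ⟨e⟩ := h₂.nonempty_iso h' (by
    rw [map_add, ← push_comp, ← push_comp, biprod.inl_snd, biprod.inr_snd, push_id, push_zero,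
      zero_add])
  obtain ⟨e'⟩ := h₂'.nonempty_iso h (by
    rw [map_add, ← push_comp, ← push_comp, biprod.inl_fst, biprod.inr_fst, push_id, push_zero,
      add_zero])
  exact ⟨P, hasTriangle_of_iso (Iso.refl _) (Iso.refl _) e' ⟨_, _, _, h₁'⟩,
    hasTriangle_of_iso (Iso.refl _) (Iso.refl _) e ⟨_, _, _, h₁⟩⟩

/-- The properties of the relation "there is a triangle `A ⟶ B ⟶ Z`" that the theory of the index
uses. They are invariant under reversing all triangles, so that every statement deduced from them
has a dual. -/
structure IsTriangleRel (Tri : C → C → C → Prop) : Prop where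
  of_iso : ∀ {A B Z A' B' Z' : C}, (A ≅ A') → (B ≅ B') → (Z ≅ Z') → Tri A B Z → Tri A' B' Z'
  biprod : ∀ A Z : C, Tri A (A ⊞ Z) Z
  sum : ∀ {A B Z A' B' Z' : C}, Tri A B Z → Tri A' B' Z' → Tri (A ⊞ A') (B ⊞ B') (Z ⊞ Z')
  pushout : ∀ {X Y Z Y' Z' : C}, Tri X Y Z → Tri X Y' Z' → ∃ P, Tri Y P Z' ∧ Tri Y' P Z
  pullback : ∀ {A B Z A' B' : C}, Tri A B Z → Tri A' B' Z → ∃ P, Tri A' P B ∧ Tri A P B'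
  comp : ∀ {A B D X F : C}, Tri A B D → Tri B X F → ∃ G, Tri A X G ∧ Tri D G F
  comp_op : ∀ {A B D X F : C}, Tri D A B → Tri F B X → ∃ G, Tri G A X ∧ Tri D G F
  iso_of_zero_right : ∀ {A B : C}, Tri A B 0 → Nonempty (A ≅ B)
  iso_of_zero_left : ∀ {B Z : C}, Tri 0 B Z → Nonempty (B ≅ Z)

/-- The projection `A ⊞ Z ≅ A` for a zero object `Z`. -/
noncomputable def biprodIsoLeft (A : C) {Z : C} (hZ : IsZero Z) : A ⊞ Z ≅ A where
  hom := biprod.fst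
  inv := biprod.inl
  hom_inv_id := by ext <;> simp; exact hZ.eq_of_src _ _

/-- The projection `A ⊞ Z ≅ Z` for a zero object `A`. -/
noncomputable def biprodIsoRight {A : C} (hA : IsZero A) (Z : C) : A ⊞ Z ≅ Z where
  hom := biprod.snd
  inv := biprod.inr
  hom_inv_id := by ext <;> simp; exact hA.eq_of_src _ _

variable (S) in
theorem isTriangleRel_hasTriangle : IsTriangleRel (HasTriangle S) where
  of_iso := hasTriangle_of_iso
  biprod := hasTriangle_biprod
  sum := hasTriangle_sum
  pushout := hasTriangle_pushout
  pullback := hasTriangle_pullback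
  comp := hasTriangle_comp
  comp_op := hasTriangle_comp_op
  iso_of_zero_right h :=
    (nonempty_iso_biprod_of_subsingleton ⟨fun a b => by
      rw [ext_eq_zero_of_isZero_left S (isZero_zero C) a,
        ext_eq_zero_of_isZero_left S (isZero_zero C) b]⟩ h).map
      fun e => (e ≪≫ biprodIsoLeft _ (isZero_zero C)).symm
  iso_of_zero_left h :=
    (nonempty_iso_biprod_of_subsingleton ⟨fun a b => by
      rw [ext_eq_zero_of_isZero_right S (isZero_zero C) a,
        ext_eq_zero_of_isZero_right S (isZero_zero C) b]⟩ h).map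
      fun e => e ≪≫ biprodIsoRight (isZero_zero C) _

/-- The relation with all triangles reversed. -/
def reverseRel (Tri : C → C → C → Prop) : C → C → C → Prop := fun A B Z => Tri Z B A

theorem IsTriangleRel.reverse {Tri : C → C → C → Prop} (h : IsTriangleRel Tri) :
    IsTriangleRel (reverseRel Tri) where
  of_iso a b c t := h.of_iso c b a t
  biprod A Z := h.of_iso (Iso.refl _) (biprod.braiding Z A) (Iso.refl _) (h.biprod Z A)
  sum t t' := h.sum t t'
  pushout t t' := (h.pullback t t').imp fun _ p => p
  pullback t t' := (h.pushout t t').imp fun _ p => p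
  comp t t' := h.comp_op t' t
  comp_op t t' := h.comp t' t
  iso_of_zero_right t := (h.iso_of_zero_left t).map Iso.symm
  iso_of_zero_left t := (h.iso_of_zero_right t).map Iso.symm

end Extri

namespace Extri

/-! ### The coend `∫^X F(X) ⊗ E(Z, X)` -/

section Tensor

variable {C : Type u} [Category.{v} C] (E : Cᵒᵖ ⥤ C ⥤ AddCommGrpCat.{w})
  (F : Cᵒᵖ ⥤ AddCommGrpCat.{max u w})

/-- The element `α ⊗ β` of `∫^X F(X) ⊗ E(Z, X)`. -/
def tmk {X Z : C} (α : F.obj (op X)) (β : ExtGroup E Z X) : (tensorExt E F).obj (op Z) :=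
  QuotientAddGroup.mk' (tensorRel E F Z) (FreeAbelianGroup.of ⟨X, α, β⟩)

variable {E F}

theorem tmk_eq_zero_iff {X Z : C} (α : F.obj (op X)) (β : ExtGroup E Z X) :
    tmk E F α β = 0 ↔ FreeAbelianGroup.of ⟨X, α, β⟩ ∈ tensorRel E F Z :=
  QuotientAddGroup.eq_zero_iff _

theorem tmk_add_left {X Z : C} (α α' : F.obj (op X)) (β : ExtGroup E Z X) :
    tmk E F (α + α') β = tmk E F α β + tmk E F α' β := by
  rw [← sub_eq_zero, ← sub_sub]
  exact (QuotientAddGroup.eq_zero_iff _).2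
    (AddSubgroup.subset_closure (TensorRel.add_left α α' β))

theorem tmk_add_right {X Z : C} (α : F.obj (op X)) (β β' : ExtGroup E Z X) :
    tmk E F α (β + β') = tmk E F α β + tmk E F α β' := by
  rw [← sub_eq_zero, ← sub_sub]
  exact (QuotientAddGroup.eq_zero_iff _).2
    (AddSubgroup.subset_closure (TensorRel.add_right α β β'))

theorem tmk_map {X X' Z : C} (f : X ⟶ X') (α : F.obj (op X')) (β : ExtGroup E Z X) :
    tmk E F (F.map f.op α) β = tmk E F α (push E Z f β) := by
  rw [← sub_eq_zero]
  exact (QuotientAddGroup.eq_zero_iff _).2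
    (AddSubgroup.subset_closure (TensorRel.balanced f α β))

theorem tmk_zero_left {X Z : C} (β : ExtGroup E Z X) : tmk E F 0 β = 0 := by
  simpa using tmk_add_left (0 : F.obj (op X)) 0 β

theorem tmk_zero_right {X Z : C} (α : F.obj (op X)) :
    tmk E F α (0 : ExtGroup E Z X) = 0 := by
  simpa using tmk_add_right α (0 : ExtGroup E Z X) 0

theorem tmk_neg_left {X Z : C} (α : F.obj (op X)) (β : ExtGroup E Z X) :
    tmk E F (-α) β = -tmk E F α β := by
  rw [eq_neg_iff_add_eq_zero, ← tmk_add_left, neg_add_cancel, tmk_zero_left]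

theorem tensorExt_map_tmk {X Z Z' : C} (c : Z' ⟶ Z) (α : F.obj (op X)) (β : ExtGroup E Z X) :
    (tensorExt E F).map c.op (tmk E F α β) = tmk E F α (pull E c X β) := by
  rfl

/-- A natural transformation `F ⟶ G` acts on `∫^X F(X) ⊗ E(Z, X)` by `α ⊗ β ↦ f(α) ⊗ β`. -/
def tensorExtMap {F G : Cᵒᵖ ⥤ AddCommGrpCat.{max u w}} (f : F ⟶ G) :
    tensorExt E F ⟶ tensorExt E G where
  app Z := AddCommGrpCat.ofHom (QuotientAddGroup.map _ _
    (FreeAbelianGroup.map fun t : TensorGen E F Z.unop => ⟨t.1, f.app (op t.1) t.2.1, t.2.2⟩) (by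
      refine (AddSubgroup.closure_le _).2 ?_
      rintro _ (⟨α, α', β⟩ | ⟨α, β, β'⟩ | ⟨g, α, β⟩) <;>
        refine AddSubgroup.subset_closure ?_ <;>
        simp only [map_sub, FreeAbelianGroup.map_of_apply, map_add, Set.mem_ofPred_eq]
      · exact TensorRel.add_left _ _ _
      · exact TensorRel.add_right _ _ _
      · have := TensorRel.balanced (E := E) (F := G) g (f.app _ α) β
        have hα : G.map g.op (f.app _ α) = f.app _ (F.map g.op α) :=
          (ConcreteCategory.congr_hom (f.naturality g.op) α).symm
        change TensorRel E G Z.unop (FreeAbelianGroup.of ⟨_, f.app _ (F.map g.op α), β⟩ - _)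
        rw [← hα]
        exact this))
  naturality Z Z' c := by
    ext : 1
    refine QuotientAddGroup.addMonoidHom_ext _ (FreeAbelianGroup.lift_ext _ _ ?_)
    rintro ⟨X, α, β⟩
    rfl

theorem tensorExtMap_tmk {F G : Cᵒᵖ ⥤ AddCommGrpCat.{max u w}} (f : F ⟶ G) {X Z : C}
    (α : F.obj (op X)) (β : ExtGroup E Z X) :
    (tensorExtMap f).app (op Z) (tmk E F α β) = tmk E G (f.app (op X) α) β :=
  rfl

end Tensor

section Map

variable {C : Type u} [Category.{v} C] {F : Cᵒᵖ ⥤ AddCommGrpCat.{max u w}}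

theorem map_comp_apply {X X' X'' : C} (f : X ⟶ X') (g : X' ⟶ X'') (α : F.obj (op X'')) :
    F.map (f ≫ g).op α = F.map f.op (F.map g.op α) := by
  simp

theorem map_add_apply [Preadditive C] [F.Additive] {X X' : C} (f g : X ⟶ X')
    (α : F.obj (op X')) : F.map (f + g).op α = F.map f.op α + F.map g.op α := by
  rw [op_add, F.map_add]; rfl

theorem map_zero_apply [Preadditive C] [F.Additive] {X X' : C} (α : F.obj (op X')) :
    F.map (0 : X ⟶ X').op α = 0 := by
  simp

end Map

variable {C : Type u} [Category.{v} C] [Preadditive C] [HasZeroObject C] [HasBinaryBiproducts C]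
  (S : Extriangulation.{w} C) {F : Cᵒᵖ ⥤ AddCommGrpCat.{max u w}}

/-- Every element of `∫^X F(X) ⊗ E(Z, X)` is a pure tensor: a sum of two of them is one over the
biproduct. -/
theorem exists_eq_tmk [F.Additive] {Z : C} (ξ : (tensorExt S.E F).obj (op Z)) :
    ∃ (X : C) (α : F.obj (op X)) (β : ExtGroup S.E Z X), ξ = tmk S.E F α β := by
  obtain ⟨ξ, rfl⟩ := QuotientAddGroup.mk_surjective ξ
  induction ξ using FreeAbelianGroup.induction_on with
  | zero => exact ⟨Z, 0, 0, (tmk_zero_left _).symm⟩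
  | of t => exact ⟨t.1, t.2.1, t.2.2, rfl⟩
  | neg t h =>
    exact ⟨t.1, -t.2.1, t.2.2, (tmk_neg_left _ _).symm⟩
  | add a b ha hb =>
    obtain ⟨X, α, β, h⟩ := ha
    obtain ⟨X', α', β', h'⟩ := hb
    refine ⟨X ⊞ X', F.map biprod.fst.op α + F.map biprod.snd.op α',
      push S.E Z biprod.inl β + push S.E Z biprod.inr β', ?_⟩
    rw [QuotientAddGroup.mk_add, h, h', tmk_add_left, tmk_map, tmk_map, map_add, map_add,
      ← push_comp, ← push_comp, ← push_comp, ← push_comp, biprod.inl_fst, biprod.inl_snd,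
      biprod.inr_fst, biprod.inr_snd, push_id, push_id, push_zero, push_zero, add_zero, zero_add]
    rfl

instance tensorExt_additive : (tensorExt S.E F).Additive where
  map_add {Z Z' c c'} := by
    ext : 1
    refine QuotientAddGroup.addMonoidHom_ext _ (FreeAbelianGroup.lift_ext _ _ ?_)
    rintro ⟨X, α, β⟩
    change tmk S.E F α (pull S.E (c.unop + c'.unop) X β) =
      tmk S.E F α (pull S.E c.unop X β) + tmk S.E F α (pull S.E c'.unop X β)
    rw [pull_add, tmk_add_right]

instance posExt_additive (A : C) : ∀ n, (posExt S.E A n).Additive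
  | 0 => ⟨fun {Z Z' c c'} => by
      ext β
      refine ULift.ext _ _ ?_
      exact pull_add S c.unop c'.unop β.down⟩
  | _ + 1 => tensorExt_additive S

/-! ### Exactness of the higher extensions in the first variable -/

/-- `F(Z) ⟶ F(B) ⟶ F(A)` is exact for all triangles `A ⟶ B ⟶ Z`. -/
def HalfExact (F : Cᵒᵖ ⥤ AddCommGrpCat.{max u w}) : Prop :=
  ∀ ⦃A B Z : C⦄ ⦃δ : ExtGroup S.E Z A⦄ ⦃x : A ⟶ B⦄ ⦃y : B ⟶ Z⦄, Realizes S.s δ x y →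
    ∀ β : F.obj (op B), F.map x.op β = 0 → ∃ γ : F.obj (op Z), F.map y.op γ = β

open Classical in
/-- For an extension `κ` of `Z` by `K` realized by `K ⟶ W ⟶ Z`, the map from formal sums of tensors
`α ⊗ β` to `F(K) / k^* F(W)` that sends `α ⊗ u_* κ` to the class of `u^* α`, and `α ⊗ β` to `0` if
`β` is not of the form `u_* κ`. It respects the relations of the coend that only involve extensions
of the form `u_* κ`. -/
noncomputable def detect (F : Cᵒᵖ ⥤ AddCommGrpCat.{max u w}) {K W Z : C} (κ : ExtGroup S.E Z K)
    (k : K ⟶ W) :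
    FreeAbelianGroup (TensorGen S.E F Z) →+ F.obj (op K) ⧸ (F.map k.op).hom.range :=
  FreeAbelianGroup.lift fun t =>
    if h : ∃ u : K ⟶ t.1, push S.E Z u κ = t.2.2 then
      QuotientAddGroup.mk (F.map h.choose.op t.2.1) else 0

variable {S}

theorem detect_of [F.Additive] {K W Z X : C} {κ : ExtGroup S.E Z K} {k : K ⟶ W} {p : W ⟶ Z}
    (hκ : Realizes S.s κ k p) (u : K ⟶ X) (α : F.obj (op X)) (β : ExtGroup S.E Z X)
    (hβ : push S.E Z u κ = β) :
    detect S F κ k (FreeAbelianGroup.of ⟨X, α, β⟩) = QuotientAddGroup.mk (F.map u.op α) := by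
  have h : ∃ u : K ⟶ X, push S.E Z u κ = β := ⟨u, hβ⟩
  rw [detect, FreeAbelianGroup.lift_apply_of, dif_pos h]
  obtain ⟨v, hv⟩ := hκ.exists_extension (-h.choose + u) (by
    have := push_add S h.choose (-h.choose + u) κ
    rw [add_neg_cancel_left, h.choose_spec, hβ] at this
    simpa using this)
  refine QuotientAddGroup.eq.2 ⟨F.map v.op α, ?_⟩
  rw [neg_add_eq_sub, eq_sub_iff_add_eq]
  change F.map k.op (F.map v.op α) + _ = _
  rw [← map_comp_apply, hv, ← map_add_apply]
  exact congrArg (fun f : K ⟶ X => F.map f.op α) (by abel)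

/-- Finitely many relations of the coend only involve extensions that are pushed forward from a
single one. -/
theorem exists_detect_eq_zero [F.Additive] {Z : C} {ξ : FreeAbelianGroup (TensorGen S.E F Z)}
    (hξ : ξ ∈ tensorRel S.E F Z) : ∃ (X₀ : C) (β₀ : ExtGroup S.E Z X₀),
    ∀ {K W : C} {κ : ExtGroup S.E Z K} {k : K ⟶ W} {p : W ⟶ Z}, Realizes S.s κ k p →
      ∀ u : K ⟶ X₀, push S.E Z u κ = β₀ → detect S F κ k ξ = 0 := by
  induction hξ using AddSubgroup.closure_induction with
  | mem ξ hξ =>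
    obtain ⟨α, α', β⟩ | ⟨α, β, β'⟩ | ⟨f, α, β⟩ := hξ
    · refine ⟨_, β, fun hκ u hu => ?_⟩
      rw [map_sub, map_sub, detect_of hκ u _ _ hu, detect_of hκ u _ _ hu, detect_of hκ u _ _ hu,
        map_add, QuotientAddGroup.mk_add]
      simp
    · rename_i X
      refine ⟨X ⊞ X, push S.E Z biprod.inl β + push S.E Z biprod.inr β',
        fun {_ _ κ _ _} hκ u hu => ?_⟩
      have h₁ : push S.E Z (u ≫ biprod.fst) κ = β := by
        rw [push_comp, hu, map_add, ← push_comp, ← push_comp]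
        simp [push_id, push_zero]
      have h₂ : push S.E Z (u ≫ biprod.snd) κ = β' := by
        rw [push_comp, hu, map_add, ← push_comp, ← push_comp]
        simp [push_id, push_zero]
      rw [map_sub, map_sub, detect_of hκ _ _ _ h₁, detect_of hκ _ _ _ h₂,
        detect_of hκ (u ≫ biprod.fst + u ≫ biprod.snd) _ _ (by rw [push_add, h₁, h₂]),
        map_add_apply, QuotientAddGroup.mk_add]
      simp
    · refine ⟨_, β, fun hκ u hu => ?_⟩
      rw [map_sub, detect_of hκ u _ _ hu, detect_of hκ (u ≫ f) _ _ (by rw [push_comp, hu]),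
        map_comp_apply]
      exact sub_self _
  | zero => exact ⟨Z, 0, fun _ _ _ => map_zero _⟩
  | neg ξ _ h =>
    obtain ⟨X₀, β₀, h⟩ := h
    exact ⟨X₀, β₀, fun hκ u hu => by rw [map_neg, h hκ u hu, neg_zero]⟩
  | add ξ ξ' _ _ h h' =>
    obtain ⟨X₀, β₀, h⟩ := h
    obtain ⟨X₁, β₁, h'⟩ := h'
    refine ⟨X₀ ⊞ X₁, push S.E Z biprod.inl β₀ + push S.E Z biprod.inr β₁, fun hκ u hu => ?_⟩
    rw [map_add, h hκ (u ≫ biprod.fst) (by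
        rw [push_comp, hu, map_add, ← push_comp, ← push_comp]; simp [push_id, push_zero]),
      h' hκ (u ≫ biprod.snd) (by
        rw [push_comp, hu, map_add, ← push_comp, ← push_comp]; simp [push_id, push_zero]),
      add_zero]

/-- Exactness of `F(B) ⟶ F(A) ⟶ ∫^X F(X) ⊗ E(Z, X)`, where the second map is `α ↦ α ⊗ δ`. -/
theorem HalfExact.exists_of_tmk_eq_zero [F.Additive] (hF : HalfExact S F) {A B Z : C}
    {δ : ExtGroup S.E Z A} {x : A ⟶ B} {y : B ⟶ Z} (h : Realizes S.s δ x y) (α : F.obj (op A))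
    (hα : tmk S.E F α δ = 0) : ∃ β : F.obj (op B), F.map x.op β = α := by
  obtain ⟨X₀, β₀, h₀⟩ := exists_detect_eq_zero ((tmk_eq_zero_iff α δ).1 hα)
  -- An extension of which both `δ` and `β₀` are pushouts.
  let κ : ExtGroup S.E Z (A ⊞ X₀) := push S.E Z biprod.inl δ + push S.E Z biprod.inr β₀
  obtain ⟨W, k, p, hκ⟩ := exists_realizes S κ
  have hfst : push S.E Z biprod.fst κ = δ := by
    rw [map_add, ← push_comp, ← push_comp]; simp [push_id, push_zero]
  have hsnd : push S.E Z biprod.snd κ = β₀ := by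
    rw [map_add, ← push_comp, ← push_comp]; simp [push_id, push_zero]
  have h₁ := h₀ hκ biprod.snd hsnd
  rw [detect_of hκ biprod.fst α δ hfst, QuotientAddGroup.eq_zero_iff] at h₁
  obtain ⟨ω, hω⟩ := h₁
  replace hω : F.map k.op ω = F.map (biprod.fst : A ⊞ X₀ ⟶ A).op α := hω
  obtain ⟨G, h', d, e, δ'', hG, hd, he, hd', -, -⟩ := S.et4 (realizes_inr_fst X₀ A) hκ
  rw [hfst] at hd'
  obtain ⟨b, hb, -⟩ := h.exists_iso hd'
  -- `X₀ ⟶ W ⟶ G ≅ B` is a triangle and `ω` vanishes on `X₀`, so `ω` comes from `B`.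
  obtain ⟨γ, hγ⟩ := hF hG ω (by
    rw [map_comp_apply, hω, ← map_comp_apply, biprod.inr_fst, map_zero_apply])
  refine ⟨F.map b.hom.op γ, ?_⟩
  have hk : (biprod.inl ≫ k) ≫ h' = d := by rw [Category.assoc, ← hd, biprod.inl_fst_assoc]
  rw [← map_comp_apply, hb, ← hk, map_comp_apply, hγ, map_comp_apply, hω, ← map_comp_apply,
    biprod.inl_fst]
  simp

/-- If `F` is half-exact, so is `Z ↦ ∫^X F(X) ⊗ E(Z, X)`: an element `α ⊗ β` over `B` that vanishes
on `A` has `α` extending to the middle term of `x^* β`, over which `β` becomes a restriction from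
`Z`. -/
theorem HalfExact.tensorExt [F.Additive] (hF : HalfExact S F) :
    HalfExact S (tensorExt S.E F) := by
  intro A B Z δ x y h ξ hξ
  obtain ⟨X, α, β, rfl⟩ := exists_eq_tmk S ξ
  rw [tensorExt_map_tmk] at hξ
  obtain ⟨Y, i, r, hβ⟩ := exists_realizes S β
  obtain ⟨G, h', d, e, δ'', -, -, -, hd, -, hδ⟩ := S.et4_op hβ h
  obtain ⟨ω, rfl⟩ := hF.exists_of_tmk_eq_zero hd α hξ
  exact ⟨tmk S.E F ω δ'', by rw [tensorExt_map_tmk, tmk_map, hδ]⟩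

theorem halfExact_posExt (N : C) : ∀ n, HalfExact S (posExt S.E N n)
  | 0 => fun A B Z δ x y h β hβ => by
    obtain ⟨β⟩ := β
    replace hβ : pull S.E x N β = 0 := congrArg ULift.down hβ
    obtain ⟨Y, i, r, hY⟩ := exists_realizes S β
    obtain ⟨G, h', d, e, δ'', -, -, -, hd, -, hδ⟩ := S.et4_op hY h
    -- Since `x^* β` vanishes, the inflation `d` is split by some `s`.
    obtain ⟨s, hs⟩ := hd.exists_extension (𝟙 N) (by rw [hβ, map_zero])
    refine ⟨ULift.up (push S.E Z s δ''), ULift.ext _ _ ?_⟩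
    change pull S.E y N (push S.E Z s δ'') = β
    rw [pull_push, ← hδ, ← push_comp, hs, push_id]
  | n + 1 => (halfExact_posExt N n).tensorExt

/-- `E^{n+1}(B, N) = 0` and `E^{n+2}(Z, N) = 0` imply `E^{n+1}(A, N) = 0`. -/
theorem subsingleton_posExt_left {A B Z N : C} (h : HasTriangle S A B Z) (n : ℕ)
    (hB : Subsingleton ((posExt S.E N n).obj (op B)))
    (hZ : Subsingleton ((posExt S.E N (n + 1)).obj (op Z))) :
    Subsingleton ((posExt S.E N n).obj (op A)) := by
  obtain ⟨x, y, δ, h⟩ := h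
  refine subsingleton_of_forall_eq 0 fun α => ?_
  obtain ⟨β, rfl⟩ := (halfExact_posExt N n).exists_of_tmk_eq_zero h α (hZ.elim _ _)
  rw [hB.elim β 0, map_zero]

/-! ### Exactness of the higher extensions in the second variable -/

/-- Every element of `F` is annihilated by the deflation of some triangle. -/
def Effaceable (S : Extriangulation.{w} C) (F : Cᵒᵖ ⥤ AddCommGrpCat.{max u w}) : Prop :=
  ∀ ⦃Y : C⦄ (η : F.obj (op Y)), ∃ (X W : C) (δ : ExtGroup S.E Y X) (x : X ⟶ W) (y : W ⟶ Y),
    Realizes S.s δ x y ∧ F.map y.op η = 0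

theorem effaceable_posExt (N : C) : ∀ n, Effaceable S (posExt S.E N n)
  | 0 => fun Y η => by
    obtain ⟨W, x, y, h⟩ := exists_realizes S η.down
    exact ⟨N, W, _, x, y, h, ULift.ext _ _ h.pull_eq_zero⟩
  | n + 1 => fun Y η => by
    obtain ⟨X, α, β, rfl⟩ := exists_eq_tmk S η
    obtain ⟨W, x, y, h⟩ := exists_realizes S β
    refine ⟨X, W, _, x, y, h, ?_⟩
    change (tensorExt S.E (posExt S.E N n)).map y.op _ = 0
    rw [tensorExt_map_tmk, h.pull_eq_zero, tmk_zero_right]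

/-- Exactness of `F ⟶ G ⟶ H` at `G`. -/
def ExactAt {F G H : Cᵒᵖ ⥤ AddCommGrpCat.{max u w}} (f : F ⟶ G) (g : G ⟶ H) : Prop :=
  ∀ ⦃N : C⦄ (γ : G.obj (op N)), g.app (op N) γ = 0 → ∃ φ : F.obj (op N), f.app (op N) φ = γ

/-- Tensoring with `E` preserves exactness of `F ⟶ G ⟶ H` at `G`. If `α ⊗ β` goes to zero, then
`g(α)` is the restriction of some `η` to the kernel of a deflation; since `η` is effaceable, it is
zero after enlarging the deflation. -/
theorem ExactAt.tensorExtMap {F G H : Cᵒᵖ ⥤ AddCommGrpCat.{max u w}} [G.Additive] [H.Additive]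
    {f : F ⟶ G} {g : G ⟶ H} (hfg : ExactAt f g) (hH : HalfExact S H) (hH' : Effaceable S H) :
    ExactAt (tensorExtMap (E := S.E) f) (tensorExtMap g) := by
  intro N γ hγ
  obtain ⟨X, α, β, rfl⟩ := exists_eq_tmk S γ
  rw [tensorExtMap_tmk] at hγ
  obtain ⟨Y, z, q, hβ⟩ := exists_realizes S β
  obtain ⟨η, hη⟩ := hH.exists_of_tmk_eq_zero hβ _ hγ
  obtain ⟨X', W, δ, x, r, hδ, hr⟩ := hH' η
  -- Over the composite deflation `W ⟶ Y ⟶ N`, `β` is the pushout of `κ` along `u`.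
  obtain ⟨K, z', -, u, κ, -, -, hz, -, hκ, -⟩ := S.et4_op hδ hβ
  obtain ⟨φ, hφ⟩ := hfg (G.map u.op α) (by
    have := ConcreteCategory.congr_hom (g.naturality u.op) α
    refine this.trans ?_
    change H.map u.op (g.app (op X) α) = 0
    rw [← hη, ← map_comp_apply, ← hz, map_comp_apply, hr, map_zero])
  exact ⟨tmk S.E F φ κ, by rw [tensorExtMap_tmk, hφ, tmk_map, hκ]⟩

/-- The map `E^{n+1}(-, A) ⟶ E^{n+1}(-, B)` induced by `A ⟶ B`. -/
def posExtMap (S : Extriangulation.{w} C) {A B : C} (x : A ⟶ B) :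
    ∀ n, posExt S.E A n ⟶ posExt S.E B n
  | 0 => Functor.whiskerRight (S.E.flip.map x) _
  | n + 1 => tensorExtMap (posExtMap S x n)

/-- The connecting map `E^{n+1}(-, Z) ⟶ E^{n+2}(-, A)` given by an extension `δ` of `Z` by `A`,
`β₁ ⊗ ⋯ ⊗ βₙ₊₁ ↦ δ ⊗ β₁ ⊗ ⋯ ⊗ βₙ₊₁`. -/
def posExtConnecting (S : Extriangulation.{w} C) {A Z : C} (δ : ExtGroup S.E Z A) :
    ∀ n, posExt S.E Z n ⟶ posExt S.E A (n + 1)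
  | 0 =>
    { app _ := AddCommGrpCat.ofHom (AddMonoidHom.mk'
        (fun β => tmk S.E (posExt S.E A 0) (ULift.up δ) β.down)
        fun β β' => tmk_add_right _ β.down β'.down)
      naturality _ _ _ := rfl }
  | n + 1 => tensorExtMap (posExtConnecting S δ n)

/-- Exactness of `E^{n+1}(-, B) ⟶ E^{n+1}(-, Z) ⟶ E^{n+2}(-, A)`. -/
theorem exactAt_posExt {A B Z : C} {δ : ExtGroup S.E Z A} {x : A ⟶ B} {y : B ⟶ Z}
    (h : Realizes S.s δ x y) : ∀ n, ExactAt (posExtMap S y n) (posExtConnecting S δ n)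
  | 0 => fun _ γ hγ => by
    obtain ⟨β⟩ := γ
    obtain ⟨Y, z, q, hβ⟩ := exists_realizes S β
    obtain ⟨⟨δ'⟩, hδ'⟩ := (halfExact_posExt A 0).exists_of_tmk_eq_zero hβ (ULift.up δ) hγ
    replace hδ' : pull S.E z A δ' = δ := congrArg ULift.down hδ'
    obtain ⟨B', x', y', hB'⟩ := exists_realizes S δ'
    obtain ⟨G, h', d, e, δ'', -, -, -, hd, he, -⟩ := S.et4_op hB' hβ
    rw [hδ'] at hd
    obtain ⟨b, -, hb⟩ := hd.exists_iso h
    refine ⟨ULift.up (push S.E _ b.hom δ''), ULift.ext _ _ ?_⟩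
    change push S.E _ y (push S.E _ b.hom δ'') = β
    rw [← push_comp, hb, he]
  | n + 1 => (exactAt_posExt h n).tensorExtMap (halfExact_posExt A (n + 1))
      (effaceable_posExt A (n + 1))

/-- `E^{n+1}(N, B) = 0` and `E^{n+2}(N, A) = 0` imply `E^{n+1}(N, Z) = 0`. -/
theorem subsingleton_posExt_right {A B Z N : C} (h : HasTriangle S A B Z) (n : ℕ)
    (hB : Subsingleton ((posExt S.E B n).obj (op N)))
    (hA : Subsingleton ((posExt S.E A (n + 1)).obj (op N))) :
    Subsingleton ((posExt S.E Z n).obj (op N)) := by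
  obtain ⟨x, y, δ, h⟩ := h
  refine subsingleton_of_forall_eq 0 fun γ => ?_
  obtain ⟨φ, rfl⟩ := exactAt_posExt h n γ (hA.elim _ _)
  rw [hB.elim φ 0, map_zero]

end Extri

namespace Extri

open scoped ZeroObject

variable {C : Type u} [Category.{v} C] [Preadditive C] [HasBinaryBiproducts C]

/-! ### Classes in the split Grothendieck group -/

theorem spClass_eq_of_iso {T : ObjectProperty C} {X Y : Obj T} (e : X.1 ≅ Y.1) :
    spClass X = spClass Y := by
  have : freeClass X = freeClass Y := congrArg FreeAbelianGroup.of (Quotient.sound ⟨e⟩)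
  rw [spClass, this, spClass]

theorem spClass_biprod {T : ObjectProperty C} {A B : C} (hA : T A) (hB : T B) (hAB : T (A ⊞ B)) :
    spClass ⟨A ⊞ B, hAB⟩ = spClass ⟨A, hA⟩ + spClass ⟨B, hB⟩ := by
  rw [← sub_eq_zero, ← sub_sub]
  exact (QuotientAddGroup.eq_zero_iff _).2
    (AddSubgroup.subset_closure ⟨A, B, hA, hB, hAB, rfl⟩)

theorem spClass_zero [HasZeroObject C] {T : ObjectProperty C} (hT : IsAdditiveSubcategory T)
    {X : Obj T} (hX : IsZero X.1) : spClass X = 0 := by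
  have h := spClass_biprod X.2 X.2 (hT.biprod X.2 X.2)
  rw [spClass_eq_of_iso (Y := X) (biprodIsoLeft X.1 hX)] at h
  simpa using h

/-! ### Coresolutions and their alternating sums -/

/-- `IsResolved Tri M t X g`: there is a coresolution of `X` of length `t` by objects of `M`, built
from the triangles of `Tri`, with alternating sum `g`. For the reversed relation these are
resolutions. -/
inductive IsResolved (Tri : C → C → C → Prop) (M : ObjectProperty C) : ℕ → C → K0sp M → Prop
  | zero {X Y : C} (hY : M Y) (e : X ≅ Y) : IsResolved Tri M 0 X (spClass ⟨Y, hY⟩)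
  | succ {X Y K : C} {t : ℕ} {g : K0sp M} (hY : M Y) (h : Tri X Y K)
      (hK : IsResolved Tri M t K g) : IsResolved Tri M (t + 1) X (spClass ⟨Y, hY⟩ - g)

/-- Triangles `N ⟶ B ⟶ Z` with `N` in `M` and `Z` of coresolution length less than `d` split. -/
def SplitsBelow (Tri : C → C → C → Prop) (M : ObjectProperty C) (d : ℕ) : Prop :=
  ∀ ⦃j : ℕ⦄, j < d → ∀ ⦃Z N B : C⦄ ⦃g : K0sp M⦄, IsResolved Tri M j Z g → M N → Tri N B Z →
    Nonempty (B ≅ N ⊞ Z)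

variable {Tri : C → C → C → Prop} {M : ObjectProperty C}

/-- Moving `X` along a sequence of triangles with middle terms in `M` shifts the length from its
coresolution to its resolution, and changes the difference of the two alternating sums only by a
sign. -/
theorem IsResolved.exists_shift {s m : ℕ} {X : C} {g h : K0sp M}
    (hg : IsResolved (reverseRel Tri) M s X g) (hh : IsResolved Tri M (m + 1) X h) :
    ∃ (X' : C) (g' h' : K0sp M), IsResolved (reverseRel Tri) M (s + m) X' g' ∧
      IsResolved Tri M 1 X' h' ∧ (g - h = g' - h' ∨ g - h = -(g' - h')) := by
  induction m generalizing s X g h with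
  | zero => exact ⟨X, g, h, hg, hh, Or.inl rfl⟩
  | succ m ih =>
    obtain _ | ⟨hY, h, hK⟩ := hh
    obtain ⟨X', g', h', h₁, h₂, h₃⟩ := ih (hg.succ (Tri := reverseRel Tri) hY h) hK
    refine ⟨X', g', h', by rwa [Nat.add_right_comm] at h₁, h₂, ?_⟩
    rcases h₃ with h₃ | h₃
    · right; rw [← h₃]; abel
    · left; rw [← neg_eq_iff_eq_neg] at h₃; rw [← h₃]; abel

variable [HasZeroObject C]

namespace IsTriangleRel

theorem of_iso_left (hT : IsTriangleRel Tri) {A B : C} (e : A ≅ B) : Tri A B 0 :=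
  hT.of_iso (Iso.refl _) (biprodIsoLeft A (isZero_zero C) ≪≫ e) (Iso.refl _) (hT.biprod A 0)

end IsTriangleRel

namespace IsResolved

theorem of_iso (hT : IsTriangleRel Tri) {t : ℕ} {X X' : C} {g : K0sp M} (e : X ≅ X')
    (h : IsResolved Tri M t X g) : IsResolved Tri M t X' g := by
  cases h with
  | zero hY e' => exact zero hY (e.symm ≪≫ e')
  | succ hY h hK => exact succ hY (hT.of_iso e (Iso.refl _) (Iso.refl _) h) hK

theorem mem_of_zero (hM : IsAdditiveSubcategory M) {X : C} {g : K0sp M}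
    (h : IsResolved Tri M 0 X g) : ∃ hX : M X, g = spClass ⟨X, hX⟩ := by
  cases h with
  | zero hY e => exact ⟨hM.of_iso e.symm hY, spClass_eq_of_iso e.symm⟩

theorem of_mem (hT : IsTriangleRel Tri) (hM : IsAdditiveSubcategory M) :
    ∀ (t : ℕ) {X : C} (hX : M X), IsResolved Tri M t X (spClass ⟨X, hX⟩)
  | 0, X, hX => zero hX (Iso.refl X)
  | t + 1, X, hX => by
    have h := succ hX (hT.of_iso_left (Iso.refl X)) (of_mem hT hM t hM.zero)
    rwa [spClass_zero hM (X := ⟨0, hM.zero⟩) (isZero_zero C), sub_zero] at h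

theorem succ_length (hT : IsTriangleRel Tri) (hM : IsAdditiveSubcategory M) {t : ℕ} {X : C}
    {g : K0sp M} (h : IsResolved Tri M t X g) : IsResolved Tri M (t + 1) X g := by
  induction h with
  | zero hY e => exact (of_mem hT hM 1 hY).of_iso hT e.symm
  | succ hY h _ ih => exact succ hY h ih

theorem mono (hT : IsTriangleRel Tri) (hM : IsAdditiveSubcategory M) {s t : ℕ} (hst : s ≤ t)
    {X : C} {g : K0sp M} (h : IsResolved Tri M s X g) : IsResolved Tri M t X g := by
  induction hst with
  | refl => exact h
  | step _ ih => exact ih.succ_length hT hM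

theorem biprod (hT : IsTriangleRel Tri) (hM : IsAdditiveSubcategory M) {t : ℕ} {X X' : C}
    {g g' : K0sp M} (h : IsResolved Tri M t X g) (h' : IsResolved Tri M t X' g') :
    IsResolved Tri M t (X ⊞ X') (g + g') := by
  induction h generalizing X' g' with
  | zero hY e =>
    cases h' with
    | zero hY' e' =>
      rw [← spClass_biprod hY hY' (hM.biprod hY hY')]
      exact zero _ (biprod.mapIso e e')
  | succ hY h _ ih =>
    cases h' with
    | succ hY' h' hK' =>
      have := succ (hM.biprod hY hY') (hT.sum h h') (ih hK')
      rwa [spClass_biprod hY hY', add_sub_add_comm] at this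

/-- Schanuel's lemma: the alternating sum does not depend on the coresolution. -/
theorem unique (hT : IsTriangleRel Tri) (hM : IsAdditiveSubcategory M) {d : ℕ}
    (hd : SplitsBelow Tri M d) {t : ℕ} (ht : t ≤ d) {X : C} {g g' : K0sp M}
    (h : IsResolved Tri M t X g) (h' : IsResolved Tri M t X g') : g = g' := by
  induction t generalizing X g g' with
  | zero =>
    obtain ⟨_, rfl⟩ := h.mem_of_zero hM
    obtain ⟨_, rfl⟩ := h'.mem_of_zero hM
    rfl
  | succ t ih =>
    obtain _ | ⟨hY, h, hK⟩ := h
    obtain _ | ⟨hY', h', hK'⟩ := h'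
    -- Both `Y ⊞ K'` and `Y' ⊞ K` are isomorphic to the pushout `P`.
    obtain ⟨P, hP, hP'⟩ := hT.pushout h h'
    obtain ⟨e⟩ := hd ht hK' hY hP
    obtain ⟨e'⟩ := hd ht hK hY' hP'
    have := ih (Nat.le_of_succ_le ht)
      (((of_mem hT hM t hY).biprod hT hM hK').of_iso hT (e.symm ≪≫ e'))
      ((of_mem hT hM t hY').biprod hT hM hK)
    rwa [sub_eq_sub_iff_add_eq_add]

/-- The first step of a coresolution. At length zero the cosyzygy is a zero object, and the
truncated subtraction `0 - 1 = 0` is its length. -/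
theorem exists_triangle (hT : IsTriangleRel Tri) (hM : IsAdditiveSubcategory M) {t : ℕ} {X : C}
    {g : K0sp M} (h : IsResolved Tri M t X g) : ∃ (Y K : C) (hY : M Y) (g' : K0sp M),
      Tri X Y K ∧ IsResolved Tri M (t - 1) K g' ∧ g = spClass ⟨Y, hY⟩ - g' := by
  cases h with
  | zero hY e =>
    refine ⟨_, 0, hY, _, hT.of_iso_left e, of_mem hT hM 0 hM.zero, ?_⟩
    rw [spClass_zero hM (X := ⟨0, hM.zero⟩) (isZero_zero C), sub_zero]
  | succ hY h hK => exact ⟨_, _, hY, _, h, hK, rfl⟩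

/-- The horseshoe lemma. -/
theorem extension (hT : IsTriangleRel Tri) (hM : IsAdditiveSubcategory M) {d : ℕ}
    (hd : SplitsBelow Tri M d) {s t : ℕ} (hst : s ≤ t) (hs : s < d) {X Y Z : C} {g h : K0sp M}
    (hXYZ : Tri X Y Z) (hX : IsResolved Tri M t X g) (hZ : IsResolved Tri M s Z h) :
    IsResolved Tri M t Y (g + h) := by
  induction t generalizing s X Y Z g h with
  | zero =>
    obtain rfl : s = 0 := by omega
    obtain ⟨hX', -⟩ := hX.mem_of_zero hM
    obtain ⟨e⟩ := hd hs hZ hX' hXYZ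
    exact (hX.biprod hT hM hZ).of_iso hT e.symm
  | succ t ih =>
    obtain _ | ⟨hX₀, hX₁, hK⟩ := hX
    obtain ⟨Z₀, K', hZ₀, h', hZ₁, hK', rfl⟩ := hZ.exists_triangle hT hM
    -- The pushout `P` splits as `X₀ ⊞ Z`, hence embeds into `X₀ ⊞ Z₀`.
    obtain ⟨P, hP, hP'⟩ := hT.pushout hX₁ hXYZ
    obtain ⟨e⟩ := hd hs hZ hX₀ hP
    have hsum := hT.of_iso e.symm (Iso.refl _) (biprodIsoRight (isZero_zero C) _)
      (hT.sum (hT.of_iso_left (Iso.refl _)) hZ₁)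
    obtain ⟨G, hG, hG'⟩ := hT.comp hP' hsum
    have := succ (hM.biprod hX₀ hZ₀) hG (ih (by omega) (by omega) hG' hK hK')
    rwa [spClass_biprod hX₀ hZ₀, add_sub_add_comm] at this

/-- The alternating sums of a triangle of objects of coresolution length `d` add up to that of a
triangle `A ⟶ B ⟶ G` with `A` and `B` in `M`. -/
theorem exists_reduction (hT : IsTriangleRel Tri) (hM : IsAdditiveSubcategory M) {d : ℕ}
    (hd₀ : 1 ≤ d) (hd : SplitsBelow Tri M d) {X Y Z : C} {a b c : K0sp M} (h : Tri X Y Z)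
    (hX : IsResolved Tri M d X a) (hY : IsResolved Tri M d Y b) (hZ : IsResolved Tri M d Z c) :
    ∃ (A B G : C) (hA : M A) (hB : M B) (g : K0sp M), Tri A B G ∧ IsResolved Tri M d G g ∧
      a - b + c = spClass ⟨A, hA⟩ - spClass ⟨B, hB⟩ + g := by
  obtain ⟨X₀, K, hX₀, k, hK, hK', rfl⟩ := hX.exists_triangle hT hM
  -- Replace `X ⟶ Y ⟶ Z` by its pushout `X₀ ⟶ P ⟶ Z`.
  obtain ⟨P, hP, hP'⟩ := hT.pushout hK h
  have hPd := hY.extension hT hM hd (Nat.sub_le d 1) (by omega) hP' hK'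
  -- Then replace `P` by an object of `M`.
  obtain ⟨P₀, L, hP₀, l, hL, hL', hl⟩ := hPd.exists_triangle hT hM
  obtain ⟨G, hG, hG'⟩ := hT.comp hP hL
  refine ⟨X₀, P₀, G, hX₀, hP₀, _, hG,
    hZ.extension hT hM hd (Nat.sub_le d 1) (by omega) hG' hL', ?_⟩
  rw [eq_sub_iff_add_eq] at hl
  rw [← hl]
  abel

end IsResolved

/-- The subgroup generated by the alternating sums of triangles `A ⟶ B ⟶ X` with `A` and `B` in `M`
and `X` of coresolution length `d`. -/
def indexRel (Tri : C → C → C → Prop) (M : ObjectProperty C) (d : ℕ) : AddSubgroup (K0sp M) :=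
  AddSubgroup.closure {r | ∃ (A B X : C) (hA : M A) (hB : M B) (g : K0sp M), Tri A B X ∧
    IsResolved Tri M d X g ∧ r = spClass ⟨A, hA⟩ - spClass ⟨B, hB⟩ + g}

theorem indexRel_le_reverse (hM : IsAdditiveSubcategory M) {d : ℕ}
    (hd : 1 ≤ d) : indexRel Tri M d ≤ indexRel (reverseRel Tri) M d := by
  refine (AddSubgroup.closure_le _).2 ?_
  rintro _ ⟨A, B, X, hA, hB, g, hX, hg, rfl⟩
  have hX' : IsResolved (reverseRel Tri) M 1 X (spClass ⟨B, hB⟩ - spClass ⟨A, hA⟩) :=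
    .succ hB hX (.zero hA (Iso.refl A))
  obtain ⟨m, rfl⟩ := Nat.exists_eq_add_of_le hd
  rw [Nat.add_comm] at hg
  obtain ⟨X', g', h', hg', hh', hgh⟩ := hX'.exists_shift hg
  have hmem : g' - h' ∈ indexRel (reverseRel Tri) M (1 + m) := by
    obtain _ | ⟨hY, h, hK⟩ := hh'
    obtain ⟨hK', rfl⟩ := hK.mem_of_zero hM
    exact AddSubgroup.subset_closure ⟨_, _, X', hK', hY, g', h, hg', by abel⟩
  have heq : spClass ⟨A, hA⟩ - spClass ⟨B, hB⟩ + g =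
      -(spClass ⟨B, hB⟩ - spClass ⟨A, hA⟩ - g) := by abel
  rw [heq]
  refine neg_mem ?_
  rcases hgh with hgh | hgh <;> rw [hgh]
  · exact hmem
  · exact neg_mem hmem

theorem indexRel_reverse (hM : IsAdditiveSubcategory M) {d : ℕ}
    (hd : 1 ≤ d) : indexRel (reverseRel Tri) M d = indexRel Tri M d :=
  le_antisymm (indexRel_le_reverse hM hd) (indexRel_le_reverse hM hd)

end Extri

namespace Extri

variable {C : Type u} [Category.{v} C] [Preadditive C] [HasBinaryBiproducts C]

/-! ### Homomorphisms out of Grothendieck groups -/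

section Lift

variable {T : ObjectProperty C} {G : Type*} [AddCommGroup G]

/-- The homomorphism out of `K₀^sp(T)` given by an isomorphism invariant that is additive on direct
sums. -/
def spLift (f : Obj T → G) (hf : ∀ X Y : Obj T, (X.1 ≅ Y.1) → f X = f Y)
    (hf' : ∀ A B AB : Obj T, AB.1 = (A.1 ⊞ B.1) → f AB = f A + f B) : K0sp T →+ G :=
  QuotientAddGroup.lift _
    (FreeAbelianGroup.lift (Quotient.lift f fun X Y ⟨e⟩ => hf X Y e)) (by
      refine (AddSubgroup.closure_le _).2 ?_
      rintro _ ⟨A, B, hA, hB, hAB, rfl⟩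
      simp [freeClass, hf' ⟨A, hA⟩ ⟨B, hB⟩ ⟨A ⊞ B, hAB⟩ rfl])

@[simp]
theorem spLift_spClass (f : Obj T → G) (hf : ∀ X Y : Obj T, (X.1 ≅ Y.1) → f X = f Y)
    (hf' : ∀ A B AB : Obj T, AB.1 = (A.1 ⊞ B.1) → f AB = f A + f B) (X : Obj T) :
    spLift f hf hf' (spClass X) = f X := by
  change FreeAbelianGroup.lift _ (FreeAbelianGroup.of _) = _
  rw [FreeAbelianGroup.lift_apply_of]
  rfl

theorem K0sp_hom_ext {f g : K0sp T →+ G} (h : ∀ X : Obj T, f (spClass X) = g (spClass X)) :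
    f = g := by
  refine QuotientAddGroup.addMonoidHom_ext _ (FreeAbelianGroup.lift_ext _ _ fun X => ?_)
  induction X using Quotient.inductionOn with
  | h X => exact h X

end Lift

/-- The homomorphism `K₀^sp(M) ⟶ K₀^sp(T)` for `M ⊆ T`. -/
def spInclusion {M T : ObjectProperty C} (h : ∀ X, M X → T X) : K0sp M →+ K0sp T :=
  spLift (fun X => spClass ⟨X.1, h _ X.2⟩) (fun _ _ e => spClass_eq_of_iso e) (by
    rintro ⟨A, hA⟩ ⟨B, hB⟩ ⟨_, hAB⟩ rfl
    exact spClass_biprod _ _ _)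

@[simp]
theorem spInclusion_spClass {M T : ObjectProperty C} (h : ∀ X, M X → T X) (X : Obj M) :
    spInclusion h (spClass X) = spClass ⟨X.1, h _ X.2⟩ :=
  spLift_spClass _ _ _ X

/-- The relations of the Grothendieck group of `T` given by the triangles of `Tri`. -/
def triRel (Tri : C → C → C → Prop) (T : ObjectProperty C) : AddSubgroup (K0sp T) :=
  AddSubgroup.closure {r | ∃ A B Z : Obj T, Tri A.1 B.1 Z.1 ∧
    r = spClass A - spClass B + spClass Z}

theorem triRel_reverse (Tri : C → C → C → Prop) (T : ObjectProperty C) :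
    triRel (reverseRel Tri) T = triRel Tri T := by
  refine congrArg AddSubgroup.closure (Set.ext fun r => ⟨?_, ?_⟩) <;>
  · rintro ⟨A, B, Z, h, rfl⟩
    exact ⟨Z, B, A, h, by abel⟩

variable {Tri : C → C → C → Prop} {M T : ObjectProperty C}

/-- An index `R`, that is, a relation between the objects of `T` and `K₀^sp(M)` with the formal
properties of the alternating sum of a coresolution, identifies `K₀(T)` with a quotient of
`K₀^sp(M)`; the inverse is induced by the inclusion of `M` in `T`. -/
theorem exists_equiv_of_index (hMT : ∀ X, M X → T X) {I : AddSubgroup (K0sp M)}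
    {R : C → K0sp M → Prop} (total : ∀ X, T X → ∃ g, R X g)
    (unique : ∀ {X g g'}, R X g → R X g' → g = g')
    (of_iso : ∀ {X Y g}, (X ≅ Y) → R X g → R Y g)
    (biprod : ∀ {A B g h}, R A g → R B h → R (A ⊞ B) (g + h))
    (of_mem : ∀ {X} (hX : M X), R X (spClass ⟨X, hX⟩))
    (additive : ∀ {A B Z : Obj T} {a b c}, Tri A.1 B.1 Z.1 → R A.1 a → R B.1 b → R Z.1 c →
      a - b + c ∈ I)
    (class_mem : ∀ {X : Obj T} {g}, R X.1 g → spClass X - spInclusion hMT g ∈ triRel Tri T)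
    (rel_mem : I ≤ (triRel Tri T).comap (spInclusion hMT)) :
    ∃ e : K0sp T ⧸ triRel Tri T ≃+ K0sp M ⧸ I, ∀ (X : Obj T) (g : K0sp M), R X.1 g →
      e (QuotientAddGroup.mk (spClass X)) = QuotientAddGroup.mk g := by
  choose ind hind using fun X : Obj T => total X.1 X.2
  let φ₀ : K0sp T →+ K0sp M := spLift ind
    (fun X Y e => unique (of_iso e (hind X)) (hind Y)) (by
      rintro ⟨A, hA⟩ ⟨B, hB⟩ ⟨_, hAB⟩ rfl
      exact unique (hind _) (biprod (hind ⟨A, hA⟩) (hind ⟨B, hB⟩)))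
  have hφ₀ : ∀ X, φ₀ (spClass X) = ind X := spLift_spClass _ _ _
  let φ : K0sp T ⧸ triRel Tri T →+ K0sp M ⧸ I := QuotientAddGroup.map _ _ φ₀ (by
    refine (AddSubgroup.closure_le _).2 ?_
    rintro _ ⟨A, B, Z, h, rfl⟩
    change φ₀ _ ∈ I
    rw [map_add, map_sub, hφ₀, hφ₀, hφ₀]
    exact additive h (hind A) (hind B) (hind Z))
  let ψ : K0sp M ⧸ I →+ K0sp T ⧸ triRel Tri T :=
    QuotientAddGroup.map _ _ (spInclusion hMT) rel_mem
  have hψφ : ψ.comp φ = AddMonoidHom.id _ := by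
    refine QuotientAddGroup.addMonoidHom_ext _ (K0sp_hom_ext fun X => ?_)
    change (QuotientAddGroup.mk (spInclusion hMT (φ₀ (spClass X))) : K0sp T ⧸ triRel Tri T) =
      QuotientAddGroup.mk (spClass X)
    rw [hφ₀, QuotientAddGroup.eq, neg_add_eq_sub]
    exact class_mem (hind X)
  have hφψ : φ.comp ψ = AddMonoidHom.id _ := by
    refine QuotientAddGroup.addMonoidHom_ext _ (K0sp_hom_ext fun X => ?_)
    change (QuotientAddGroup.mk (φ₀ (spInclusion hMT (spClass X))) : K0sp M ⧸ I) =
      QuotientAddGroup.mk (spClass X)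
    rw [spInclusion_spClass, hφ₀, unique (hind ⟨X.1, _⟩) (of_mem X.2)]
  refine ⟨AddMonoidHom.toAddEquiv φ ψ hψφ hφψ, fun X g hg => ?_⟩
  change (QuotientAddGroup.mk (φ₀ (spClass X)) : K0sp M ⧸ I) = QuotientAddGroup.mk g
  rw [hφ₀, unique (hind X) hg]

/-! ### The index isomorphisms for an abstract triangle relation -/

namespace IsResolved

/-- In the Grothendieck group of `T`, the class of an object is the alternating sum of its
coresolution, provided that `T` contains the cosyzygies. -/
theorem spClass_sub_mem (hMT : ∀ X, M X → T X) {t : ℕ}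
    (hT : ∀ s ≤ t, ∀ X g, IsResolved Tri M s X g → T X) {X : C} {g : K0sp M}
    (h : IsResolved Tri M t X g) (hX : T X) :
    spClass ⟨X, hX⟩ - spInclusion hMT g ∈ triRel Tri T := by
  induction h with
  | zero hY e =>
    rw [spInclusion_spClass, spClass_eq_of_iso (Y := ⟨_, hMT _ hY⟩) e, sub_self]
    exact zero_mem _
  | @succ X Y K t g hY h hK ih =>
    have hK' : T K := hT t (Nat.le_succ t) _ _ hK
    have h₁ := ih (fun s hs => hT s (hs.trans (Nat.le_succ t))) hK'
    have h₂ : spClass ⟨X, hX⟩ - spClass ⟨Y, hMT _ hY⟩ + spClass ⟨K, hK'⟩ ∈ triRel Tri T :=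
      AddSubgroup.subset_closure ⟨⟨X, hX⟩, ⟨Y, hMT _ hY⟩, ⟨K, hK'⟩, h, rfl⟩
    convert sub_mem h₂ h₁ using 1
    rw [map_sub, spInclusion_spClass]
    abel

end IsResolved

variable [HasZeroObject C]

/-- The index isomorphism for coresolutions of a fixed length below `d`. -/
theorem exists_equiv_of_lt (hTri : IsTriangleRel Tri) (hM : IsAdditiveSubcategory M) {d : ℕ}
    (hd : SplitsBelow Tri M d) {t : ℕ} (ht : t < d)
    (hT : ∀ X, T X ↔ ∃ g, IsResolved Tri M t X g)
    {H : AddSubgroup (K0sp T)} (hH : H = triRel Tri T) :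
    ∃ e : K0sp T ⧸ H ≃+ K0sp M, ∀ (X : Obj T) (g : K0sp M),
      (∃ s ≤ d, IsResolved Tri M s X.1 g) → e (QuotientAddGroup.mk (spClass X)) = g := by
  subst hH
  have hMT : ∀ X, M X → T X := fun X hX => (hT X).2 ⟨_, .of_mem hTri hM t hX⟩
  have huniq : ∀ {X g g'}, IsResolved Tri M d X g → IsResolved Tri M d X g' → g = g' :=
    fun h h' => h.unique hTri hM hd le_rfl h'
  obtain ⟨e, he⟩ := exists_equiv_of_index (Tri := Tri) (I := ⊥) hMT
    (R := fun X g => IsResolved Tri M d X g)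
    (fun X hX => ((hT X).1 hX).imp fun g hg => hg.mono hTri hM ht.le) huniq
    (fun e h => h.of_iso hTri e) (fun h h' => h.biprod hTri hM h')
    (fun hX => .of_mem hTri hM d hX)
    (by
      intro A B Z a b c h ha hb hc
      obtain ⟨a', ha'⟩ := (hT _).1 A.2
      obtain ⟨c', hc'⟩ := (hT _).1 Z.2
      have hb' := (ha'.extension hTri hM hd le_rfl ht h hc').mono hTri hM ht.le
      rw [huniq ha (ha'.mono hTri hM ht.le), huniq hc (hc'.mono hTri hM ht.le), huniq hb hb',
        AddSubgroup.mem_bot]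
      abel)
    (by
      intro X g hg
      obtain ⟨g', hg'⟩ := (hT _).1 X.2
      rw [huniq hg (hg'.mono hTri hM ht.le)]
      exact hg'.spClass_sub_mem hMT
        (fun s hs X g h => (hT X).2 ⟨g, h.mono hTri hM hs⟩) X.2)
    bot_le
  refine ⟨e.trans (QuotientAddGroup.quotientBot (G := K0sp M)), ?_⟩
  rintro X g ⟨s, hs, hg⟩
  rw [AddEquiv.trans_apply, he X g (hg.mono hTri hM hs)]
  rfl

/-- The index isomorphism for coresolutions of length `d`, where additivity on triangles only holds
modulo `indexRel`. -/
theorem exists_equiv_of_eq (hTri : IsTriangleRel Tri) (hM : IsAdditiveSubcategory M) {d : ℕ}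
    (hd₀ : 1 ≤ d) (hd : SplitsBelow Tri M d) (hT : ∀ X, T X ↔ ∃ g, IsResolved Tri M d X g)
    {H : AddSubgroup (K0sp T)} (hH : H = triRel Tri T) {I : AddSubgroup (K0sp M)}
    (hI : I = indexRel Tri M d) :
    ∃ e : K0sp T ⧸ H ≃+ K0sp M ⧸ I, ∀ (X : Obj T) (g : K0sp M),
      (∃ s ≤ d, IsResolved Tri M s X.1 g) →
        e (QuotientAddGroup.mk (spClass X)) = QuotientAddGroup.mk g := by
  subst hH hI
  have hMT : ∀ X, M X → T X := fun X hX => (hT X).2 ⟨_, .of_mem hTri hM d hX⟩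
  have hclass : ∀ {X : Obj T} {g}, IsResolved Tri M d X.1 g →
      spClass X - spInclusion hMT g ∈ triRel Tri T := fun {X g} hg =>
    hg.spClass_sub_mem hMT (fun s hs X g h => (hT X).2 ⟨g, h.mono hTri hM hs⟩) X.2
  obtain ⟨e, he⟩ := exists_equiv_of_index (Tri := Tri) (I := indexRel Tri M d) hMT
    (R := fun X g => IsResolved Tri M d X g) (fun X hX => (hT X).1 hX)
    (fun h h' => h.unique hTri hM hd le_rfl h')
    (fun e h => h.of_iso hTri e) (fun h h' => h.biprod hTri hM h')
    (fun hX => .of_mem hTri hM d hX)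
    (by
      intro A B Z a b c h ha hb hc
      obtain ⟨A', B', G, hA', hB', g, hG, hg, hr⟩ := ha.exists_reduction hTri hM hd₀ hd h hb hc
      exact AddSubgroup.subset_closure ⟨A', B', G, hA', hB', g, hG, hg, hr⟩)
    hclass
    (by
      refine (AddSubgroup.closure_le _).2 ?_
      rintro _ ⟨A, B, X, hA, hB, g, hX, hg, rfl⟩
      have hX' : T X := (hT X).2 ⟨g, hg⟩
      have h₁ : spClass ⟨A, hMT _ hA⟩ - spClass ⟨B, hMT _ hB⟩ + spClass ⟨X, hX'⟩ ∈ triRel Tri T :=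
        AddSubgroup.subset_closure ⟨⟨A, hMT _ hA⟩, ⟨B, hMT _ hB⟩, ⟨X, hX'⟩, hX, rfl⟩
      have h₂ := hclass (X := ⟨X, hX'⟩) hg
      change spInclusion hMT _ ∈ triRel Tri T
      convert sub_mem h₁ h₂ using 1
      rw [map_add, map_sub, spInclusion_spClass, spInclusion_spClass]
      abel)
  exact ⟨e, fun X g ⟨s, hs, hg⟩ => he X g (hg.mono hTri hM hs)⟩

/-- The index isomorphism for coresolutions of arbitrary finite length. -/
theorem exists_equiv_of_forall (hTri : IsTriangleRel Tri) (hM : IsAdditiveSubcategory M)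
    (hd : ∀ d, SplitsBelow Tri M d) (hT : ∀ X, T X ↔ ∃ t, 1 ≤ t ∧ ∃ g, IsResolved Tri M t X g)
    {H : AddSubgroup (K0sp T)} (hH : H = triRel Tri T) :
    ∃ e : K0sp T ⧸ H ≃+ K0sp M, ∀ (X : Obj T) (g : K0sp M),
      (∃ s, IsResolved Tri M s X.1 g) → e (QuotientAddGroup.mk (spClass X)) = g := by
  subst hH
  have hT' : ∀ {t X g}, IsResolved Tri M t X g → T X := fun {t X g} h =>
    (hT X).2 ⟨t + 1, Nat.le_add_left 1 t, g, h.succ_length hTri hM⟩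
  have hMT : ∀ X, M X → T X := fun X hX => hT' (.of_mem hTri hM 0 hX)
  have huniq : ∀ {X g g'}, (∃ s, IsResolved Tri M s X g) → (∃ s, IsResolved Tri M s X g') →
      g = g' := fun ⟨s, h⟩ ⟨s', h'⟩ =>
    (h.mono hTri hM (le_max_left s s')).unique hTri hM (hd _) le_rfl
      (h'.mono hTri hM (le_max_right s s'))
  obtain ⟨e, he⟩ := exists_equiv_of_index (Tri := Tri) (I := ⊥) hMT
    (R := fun X g => ∃ s, IsResolved Tri M s X g)
    (fun X hX => let ⟨t, _, g, hg⟩ := (hT X).1 hX; ⟨g, t, hg⟩) huniq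
    (fun e ⟨s, h⟩ => ⟨s, h.of_iso hTri e⟩)
    (fun ⟨s, h⟩ ⟨s', h'⟩ => ⟨max s s', (h.mono hTri hM (le_max_left s s')).biprod hTri hM
      (h'.mono hTri hM (le_max_right s s'))⟩)
    (fun hX => ⟨0, .of_mem hTri hM 0 hX⟩)
    (by
      rintro A B Z a b c h ⟨s, ha⟩ hb ⟨s', hc⟩
      rw [huniq hb ⟨_, (ha.mono hTri hM (le_max_left s s')).extension hTri hM
        (hd (max s s' + 1)) le_rfl (Nat.lt_succ_self _) h
        (hc.mono hTri hM (le_max_right s s'))⟩, AddSubgroup.mem_bot]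
      abel)
    (fun {X g} ⟨s, hg⟩ => hg.spClass_sub_mem hMT (fun _ _ _ _ h => hT' h) X.2)
    bot_le
  refine ⟨e.trans (QuotientAddGroup.quotientBot (G := K0sp M)), fun X g hg => ?_⟩
  rw [AddEquiv.trans_apply, he X g hg]
  rfl

/-- A triangle `A ⟶ B ⟶ X` with `A` and `B` in `M` is a resolution of `X` of length one, so
`indexRel` is generated by differences of left and right indices. -/
theorem indexRel_eq (hTri : IsTriangleRel Tri) (hM : IsAdditiveSubcategory M) {d : ℕ}
    (hd₀ : 1 ≤ d) (hd : SplitsBelow (reverseRel Tri) M d) :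
    indexRel Tri M d = AddSubgroup.closure {r | ∃ (X : C) (g h : K0sp M),
      (∃ g, IsResolved Tri M d X g) ∧ (∃ h, IsResolved (reverseRel Tri) M 1 X h) ∧
      (∃ s ≤ d, IsResolved Tri M s X g) ∧ (∃ s ≤ d, IsResolved (reverseRel Tri) M s X h) ∧
      r = g - h} := by
  refine congrArg AddSubgroup.closure (Set.ext fun r => ⟨?_, ?_⟩)
  · rintro ⟨A, B, X, hA, hB, g, hX, hg, rfl⟩
    have h : IsResolved (reverseRel Tri) M 1 X (spClass ⟨B, hB⟩ - spClass ⟨A, hA⟩) :=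
      .succ hB hX (.zero hA (Iso.refl A))
    exact ⟨X, g, _, ⟨g, hg⟩, ⟨_, h⟩, ⟨d, le_rfl, hg⟩, ⟨1, hd₀, h⟩, by abel⟩
  · rintro ⟨X, g, h, -, ⟨h', hh'⟩, ⟨s, hs, hg⟩, ⟨s', hs', hh⟩, rfl⟩
    obtain rfl := (hh'.mono hTri.reverse hM hd₀).unique hTri.reverse hM hd le_rfl
      (hh.mono hTri.reverse hM hs')
    obtain _ | ⟨hY, hX, hK⟩ := hh'
    obtain ⟨hK', rfl⟩ := hK.mem_of_zero hM
    exact ⟨_, _, X, hK', hY, g, hX, hg.mono hTri hM hs, by abel⟩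

end Extri

namespace Extri

open scoped ZeroObject

variable {C : Type u} [Category.{v} C] [Preadditive C] [HasBinaryBiproducts C]
  {M : ObjectProperty C}

theorem altSum_singleton (Y : Obj M) : altSum [Y] = spClass Y := by
  simp [altSum]

theorem altSum_cons (Y : Obj M) (L : List (Obj M)) : altSum (Y :: L) = spClass Y - altSum L := by
  simp [altSum, List.alternatingSum_cons]

variable [HasZeroObject C]
  {S : Extriangulation.{w} C} {d : ℕ}

/-! ### Rigidity and splitting -/

theorem IsRigid.subsingleton_posExt (hM : IsRigid S M d) {i : ℕ} (hi : i < d) {X Y : C}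
    (hX : M X) (hY : M Y) : Subsingleton ((posExt S.E Y i).obj (op X)) :=
  hM.ext_eq_zero (i + 1) (Nat.le_add_left 1 i) hi hX hY

/-- `E^{i+1}(Z, M) = 0` if `Z` has a coresolution of length `j` with `i + j < d`. -/
theorem IsRigid.subsingleton_posExt_left (hM : IsRigid S M d) {j : ℕ} {Z N : C} {g : K0sp M}
    (h : IsResolved (HasTriangle S) M j Z g) (hN : M N) {i : ℕ} (hi : i + j < d) :
    Subsingleton ((posExt S.E N i).obj (op Z)) := by
  induction h generalizing i with
  | zero hY e => exact hM.subsingleton_posExt hi (hM.additive.of_iso e.symm hY) hN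
  | succ hY h _ ih =>
    exact Extri.subsingleton_posExt_left h i (hM.subsingleton_posExt (by omega) hY hN)
      (ih (by omega))

/-- `E^{i+1}(M, Z) = 0` if `Z` has a resolution of length `j` with `i + j < d`. -/
theorem IsRigid.subsingleton_posExt_right (hM : IsRigid S M d) {j : ℕ} {Z N : C} {g : K0sp M}
    (h : IsResolved (reverseRel (HasTriangle S)) M j Z g) (hN : M N) {i : ℕ} (hi : i + j < d) :
    Subsingleton ((posExt S.E Z i).obj (op N)) := by
  induction h generalizing i with
  | zero hY e => exact hM.subsingleton_posExt hi hN (hM.additive.of_iso e.symm hY)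
  | succ hY h _ ih =>
    exact Extri.subsingleton_posExt_right h i (hM.subsingleton_posExt (by omega) hN hY)
      (ih (by omega))

theorem subsingleton_extGroup {Z A : C} (h : Subsingleton ((posExt S.E A 0).obj (op Z))) :
    Subsingleton (ExtGroup S.E Z A) :=
  ⟨fun a b => congrArg ULift.down (h.elim (ULift.up a) (ULift.up b))⟩

theorem IsRigid.splitsBelow (hM : IsRigid S M d) : SplitsBelow (HasTriangle S) M d :=
  fun _ hj _ _ _ _ hZ hN h => nonempty_iso_biprod_of_subsingleton
    (subsingleton_extGroup (hM.subsingleton_posExt_left hZ hN (by omega))) h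

theorem IsRigid.splitsBelow_reverse (hM : IsRigid S M d) :
    SplitsBelow (reverseRel (HasTriangle S)) M d :=
  fun _ hj _ _ _ _ hZ hN h => (nonempty_iso_biprod_of_subsingleton
    (subsingleton_extGroup (hM.subsingleton_posExt_right hZ hN (by omega))) h).map
      fun e => e ≪≫ biprod.braiding _ _

theorem IsInftyRigid.isRigid (hM : IsInftyRigid S M) (d : ℕ) : IsRigid S M d :=
  ⟨hM.additive, fun i hi _ _ _ => hM.ext_eq_zero i hi⟩

/-! ### Filtrations as coresolutions and resolutions -/

theorem hasTriangleSeq_append_iff {A Y Z : C} {L : List C} (hL : L ≠ []) :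
    HasTriangleSeq S A (L ++ [Y]) Z ↔ ∃ K, HasTriangleSeq S A L K ∧ HasTriangle S K Y Z := by
  induction L generalizing A with
  | nil => exact absurd rfl hL
  | cons X L ih =>
    by_cases hL' : L = []
    · subst hL'
      constructor
      · rintro (_ | ⟨h, h'⟩)
        cases h' with
        | single h' => exact ⟨_, .single h, h'⟩
        | cons _ h'' => cases h''
      · rintro ⟨K, h, h'⟩
        cases h with
        | single h => exact .cons h (.single h')
        | cons _ h'' => cases h''
    · constructor
      · intro h
        rw [List.cons_append] at h
        generalize hL'' : L ++ [Y] = L'' at h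
        cases h with
        | single h => simp at hL''
        | cons h h' =>
          subst hL''
          obtain ⟨K, h₁, h₂⟩ := (ih hL').1 h'
          exact ⟨K, .cons h h₁, h₂⟩
      · rintro ⟨K, h, h'⟩
        cases h with
        | single h => exact absurd rfl hL'
        | cons h h'' => exact .cons h ((ih hL').2 ⟨K, h'', h'⟩)

theorem isLeftFiltration_zero_iff {X : C} {L : List (Obj M)} :
    IsLeftFiltration S M 0 X L ↔ ∃ Y, L = [Y] ∧ HasTriangle S X Y.1 0 := by
  constructor
  · rintro ⟨hL, h⟩
    obtain ⟨Y, rfl⟩ := List.length_eq_one_iff.1 hL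
    cases h with
    | single h => exact ⟨Y, rfl, h⟩
    | cons _ h => cases h
  · rintro ⟨Y, rfl, h⟩
    exact ⟨rfl, .single h⟩

theorem isLeftFiltration_succ_iff {t : ℕ} {X : C} {L : List (Obj M)} :
    IsLeftFiltration S M (t + 1) X L ↔
      ∃ Y L' K, L = Y :: L' ∧ HasTriangle S X Y.1 K ∧ IsLeftFiltration S M t K L' := by
  constructor
  · rintro ⟨hL, h⟩
    obtain ⟨Y, Y', L, rfl⟩ : ∃ Y Y' L', L = Y :: Y' :: L' := by
      match L, hL with
      | Y :: Y' :: L, _ => exact ⟨Y, Y', L, rfl⟩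
    cases h with
    | cons h h' => exact ⟨Y, Y' :: L, _, rfl, h, by simpa using hL, h'⟩
  · rintro ⟨Y, L', K, rfl, h, hL, h'⟩
    exact ⟨by simp [hL], .cons h h'⟩

theorem isRightFiltration_zero_iff {X : C} {L : List (Obj M)} :
    IsRightFiltration S M 0 X L ↔ ∃ Y, L = [Y] ∧ HasTriangle S 0 Y.1 X := by
  constructor
  · rintro ⟨hL, h⟩
    obtain ⟨Y, rfl⟩ := List.length_eq_one_iff.1 hL
    cases h with
    | single h => exact ⟨Y, rfl, h⟩
    | cons _ h => cases h
  · rintro ⟨Y, rfl, h⟩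
    exact ⟨rfl, .single h⟩

theorem isRightFiltration_succ_iff {t : ℕ} {X : C} {L : List (Obj M)} :
    IsRightFiltration S M (t + 1) X L ↔
      ∃ Y L' K, L = Y :: L' ∧ HasTriangle S K Y.1 X ∧ IsRightFiltration S M t K L' := by
  constructor
  · rintro ⟨hL, h⟩
    obtain ⟨Y, L, rfl⟩ := List.exists_cons_of_length_eq_add_one hL
    have hL' : L.length = t + 1 := by simpa using hL
    rw [List.reverse_cons, List.map_append, List.map_singleton, hasTriangleSeq_append_iff (by
      intro h
      rw [List.map_eq_nil_iff, List.reverse_eq_nil_iff] at h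
      simp [h] at hL')] at h
    obtain ⟨K, h, h'⟩ := h
    exact ⟨Y, L, K, rfl, h', hL', h⟩
  · rintro ⟨Y, L, K, rfl, h, hL, h'⟩
    refine ⟨by simp [hL], ?_⟩
    rw [List.reverse_cons, List.map_append, List.map_singleton, hasTriangleSeq_append_iff (by
      intro h
      rw [List.map_eq_nil_iff, List.reverse_eq_nil_iff] at h
      simp [h] at hL)]
    exact ⟨K, h', h⟩

theorem exists_isLeftFiltration_iff {t : ℕ} {X : C} {g : K0sp M} :
    (∃ L, IsLeftFiltration S M t X L ∧ g = altSum L) ↔ IsResolved (HasTriangle S) M t X g := by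
  have hTri := isTriangleRel_hasTriangle S
  induction t generalizing X g with
  | zero =>
    constructor
    · rintro ⟨L, hL, rfl⟩
      obtain ⟨Y, rfl, h⟩ := isLeftFiltration_zero_iff.1 hL
      rw [altSum_singleton]
      exact (hTri.iso_of_zero_right h).elim fun e => .zero Y.2 e
    · rintro (⟨hY, e⟩ | _)
      exact ⟨[⟨_, hY⟩], isLeftFiltration_zero_iff.2 ⟨_, rfl, hTri.of_iso_left e⟩,
        (altSum_singleton _).symm⟩
  | succ t ih =>
    constructor
    · rintro ⟨L, hL, rfl⟩
      obtain ⟨Y, L, K, rfl, h, hL⟩ := isLeftFiltration_succ_iff.1 hL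
      rw [altSum_cons]
      exact .succ Y.2 h (ih.1 ⟨L, hL, rfl⟩)
    · rintro (_ | ⟨hY, h, hK⟩)
      obtain ⟨L, hL, rfl⟩ := ih.2 hK
      exact ⟨⟨_, hY⟩ :: L, isLeftFiltration_succ_iff.2 ⟨_, L, _, rfl, h, hL⟩,
        (altSum_cons _ _).symm⟩

theorem exists_isRightFiltration_iff {t : ℕ} {X : C} {g : K0sp M} :
    (∃ L, IsRightFiltration S M t X L ∧ g = altSum L) ↔
      IsResolved (reverseRel (HasTriangle S)) M t X g := by
  have hTri := (isTriangleRel_hasTriangle S).reverse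
  induction t generalizing X g with
  | zero =>
    constructor
    · rintro ⟨L, hL, rfl⟩
      obtain ⟨Y, rfl, h⟩ := isRightFiltration_zero_iff.1 hL
      rw [altSum_singleton]
      exact (hTri.iso_of_zero_right h).elim fun e => .zero Y.2 e
    · rintro (⟨hY, e⟩ | _)
      exact ⟨[⟨_, hY⟩], isRightFiltration_zero_iff.2 ⟨_, rfl, hTri.of_iso_left e⟩,
        (altSum_singleton _).symm⟩
  | succ t ih =>
    constructor
    · rintro ⟨L, hL, rfl⟩
      obtain ⟨Y, L, K, rfl, h, hL⟩ := isRightFiltration_succ_iff.1 hL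
      rw [altSum_cons]
      exact .succ (Tri := reverseRel _) Y.2 h (ih.1 ⟨L, hL, rfl⟩)
    · rintro (_ | ⟨hY, h, hK⟩)
      obtain ⟨L, hL, rfl⟩ := ih.2 hK
      exact ⟨⟨_, hY⟩ :: L, isRightFiltration_succ_iff.2 ⟨_, L, _, rfl, h, hL⟩,
        (altSum_cons _ _).symm⟩

theorem leftPart_iff {t : ℕ} {X : C} :
    leftPart S M t X ↔ ∃ g, IsResolved (HasTriangle S) M t X g := by
  simp only [← exists_isLeftFiltration_iff]
  exact ⟨fun ⟨L, h⟩ => ⟨_, L, h, rfl⟩, fun ⟨_, L, h, _⟩ => ⟨L, h⟩⟩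

theorem rightPart_iff {t : ℕ} {X : C} :
    rightPart S M t X ↔ ∃ g, IsResolved (reverseRel (HasTriangle S)) M t X g := by
  simp only [← exists_isRightFiltration_iff]
  exact ⟨fun ⟨L, h⟩ => ⟨_, L, h, rfl⟩, fun ⟨_, L, h, _⟩ => ⟨L, h⟩⟩

theorem isLeftIndex_iff {X : C} {g : K0sp M} :
    IsLeftIndex S M d X g ↔ ∃ s ≤ d, IsResolved (HasTriangle S) M s X g := by
  simp only [IsLeftIndex, ← exists_isLeftFiltration_iff, exists_and_left]

theorem isRightIndex_iff {X : C} {g : K0sp M} :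
    IsRightIndex S M d X g ↔ ∃ s ≤ d, IsResolved (reverseRel (HasTriangle S)) M s X g := by
  simp only [IsRightIndex, ← exists_isRightFiltration_iff, exists_and_left]

theorem IsRigid.imPsi_eq (hM : IsRigid S M d) (hd : 1 ≤ d) :
    imPsi S M d = indexRel (HasTriangle S) M d := by
  rw [indexRel_eq (isTriangleRel_hasTriangle S) hM.additive hd hM.splitsBelow_reverse]
  simp only [imPsi, leftPart_iff, rightPart_iff, isLeftIndex_iff, isRightIndex_iff]

theorem IsRigid.imPhi_eq (hM : IsRigid S M d) (hd : 1 ≤ d) :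
    imPhi S M d = indexRel (reverseRel (HasTriangle S)) M d := by
  rw [indexRel_eq (isTriangleRel_hasTriangle S).reverse hM.additive hd hM.splitsBelow]
  simp only [imPhi, leftPart_iff, rightPart_iff, isLeftIndex_iff, isRightIndex_iff]
  rfl

theorem triangleRel_eq_reverse (T : ObjectProperty C) :
    triangleRel S T = triRel (reverseRel (HasTriangle S)) T :=
  (triRel_reverse _ _).symm

end Extri

open Extri in
theorem theorem3p12 {C : Type u} [Category.{v} C] [Preadditive C] [HasZeroObject C]
    [HasBinaryBiproducts C] (S : Extri.Extriangulation.{w} C) (M : ObjectProperty C)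
    (d : ℕ) (hd : 1 ≤ d) (hM : Extri.IsRigid S M d) :
    -- the case of finite length `t < d`
    (∀ t : ℕ, 1 ≤ t → t < d →
      (∃ e : Extri.K0 S (Extri.leftPart S M t) ≃+ Extri.K0sp M,
        ∀ (X : Extri.Obj (Extri.leftPart S M t)) (g : Extri.K0sp M),
          Extri.IsLeftIndex S M d X.1 g → e (Extri.k0Class S X) = g) ∧
      (∃ e : Extri.K0 S (Extri.rightPart S M t) ≃+ Extri.K0sp M,
        ∀ (X : Extri.Obj (Extri.rightPart S M t)) (g : Extri.K0sp M),
          Extri.IsRightIndex S M d X.1 g → e (Extri.k0Class S X) = g)) ∧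
    -- the case of length `d`; the two descriptions of the index Grothendieck group agree
    (Extri.imPhi S M d = Extri.imPsi S M d ∧
      (∃ e : Extri.K0 S (Extri.leftPart S M d) ≃+ Extri.K0in S M d,
        ∀ (X : Extri.Obj (Extri.leftPart S M d)) (g : Extri.K0sp M),
          Extri.IsLeftIndex S M d X.1 g →
            e (Extri.k0Class S X) = QuotientAddGroup.mk g) ∧
      (∃ e : Extri.K0 S (Extri.rightPart S M d) ≃+ Extri.K0in S M d,
        ∀ (X : Extri.Obj (Extri.rightPart S M d)) (g : Extri.K0sp M),
          Extri.IsRightIndex S M d X.1 g →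
            e (Extri.k0Class S X) = QuotientAddGroup.mk g)) ∧
    -- the case of arbitrary finite length
    (Extri.IsInftyRigid S M →
      (∃ e : Extri.K0 S (Extri.leftUnion S M) ≃+ Extri.K0sp M,
        ∀ (X : Extri.Obj (Extri.leftUnion S M)) (n : ℕ) (g : Extri.K0sp M),
          Extri.IsLeftIndex S M n X.1 g → e (Extri.k0Class S X) = g) ∧
      (∃ e : Extri.K0 S (Extri.rightUnion S M) ≃+ Extri.K0sp M,
        ∀ (X : Extri.Obj (Extri.rightUnion S M)) (n : ℕ) (g : Extri.K0sp M),
          Extri.IsRightIndex S M n X.1 g → e (Extri.k0Class S X) = g)) := by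
  have hTri := isTriangleRel_hasTriangle S
  have hrev (T : ObjectProperty C) := triangleRel_eq_reverse (S := S) T
  refine ⟨fun t _ ht => ⟨?_, ?_⟩, ⟨?_, ?_, ?_⟩, fun hM' => ⟨?_, ?_⟩⟩
  · obtain ⟨e, he⟩ := exists_equiv_of_lt (T := leftPart S M t) hTri hM.additive hM.splitsBelow ht
      (fun X => leftPart_iff) (H := triangleRel S _) rfl
    exact ⟨e, fun X g hg => he X g (isLeftIndex_iff.1 hg)⟩
  · obtain ⟨e, he⟩ := exists_equiv_of_lt (T := rightPart S M t) hTri.reverse hM.additive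
      hM.splitsBelow_reverse ht (fun X => rightPart_iff) (hrev _)
    exact ⟨e, fun X g hg => he X g (isRightIndex_iff.1 hg)⟩
  · rw [hM.imPhi_eq hd, hM.imPsi_eq hd, indexRel_reverse hM.additive hd]
  · obtain ⟨e, he⟩ := exists_equiv_of_eq (T := leftPart S M d) hTri hM.additive hd
      hM.splitsBelow (fun X => leftPart_iff) (H := triangleRel S _) rfl (hM.imPsi_eq hd)
    exact ⟨e, fun X g hg => he X g (isLeftIndex_iff.1 hg)⟩
  · obtain ⟨e, he⟩ := exists_equiv_of_eq (T := rightPart S M d) hTri.reverse hM.additive hd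
      hM.splitsBelow_reverse (fun X => rightPart_iff) (hrev _)
      ((hM.imPsi_eq hd).trans (indexRel_reverse hM.additive hd).symm)
    exact ⟨e, fun X g hg => he X g (isRightIndex_iff.1 hg)⟩
  · obtain ⟨e, he⟩ := exists_equiv_of_forall (T := leftUnion S M) hTri hM.additive
      (fun n => (hM'.isRigid n).splitsBelow) (fun X => by simp only [leftUnion, leftPart_iff])
      (H := triangleRel S _) rfl
    exact ⟨e, fun X n g hg => he X g ((isLeftIndex_iff.1 hg).imp fun _ h => h.2)⟩
  · obtain ⟨e, he⟩ := exists_equiv_of_forall (T := rightUnion S M) hTri.reverse hM.additive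
      (fun n => (hM'.isRigid n).splitsBelow_reverse)
      (fun X => by simp only [rightUnion, rightPart_iff]) (hrev _)
    exact ⟨e, fun X n g hg => he X g ((isRightIndex_iff.1 hg).imp fun _ h => h.2)⟩
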